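/- Let $\gamma>0$ and $\alpha>0$, and let $H$ be a probability measure (the base distribution) on a measurable space $\Psi$. For a measure $\nu$ on $(0,\infty)$, the completely random measure with rate measure $\nu$ and base distribution $H$ is the random measure $\Theta=\sum_k\theta_k\delta_{\psi_k}$ on $\Psi$, where $\sum_k\delta_{(\theta_k,\psi_k)}$ is a Poisson point process with rate measure $\nu\times H$. The gamma process $\Gamma\mathrm P(\gamma,\lambda,0)$ has rate measure $\gamma\lambda\,\theta^{-1}e^{-\lambda\theta}\,d\theta$ on $(0,\infty)$, and the beta process $\mathrm{BP}(\gamma,\alpha,0)$ has rate measure $\gamma\alpha\,\theta^{-1}(1-\theta)^{\alpha-1}\,d\theta$ on $(0,1]$. Write $\mathrm{Gam}(a,b)$ for the gamma distribution with shape $a$ and rate $b$, also for its density, and $\mathrm{Exp}(b)=\mathrm{Gam}(1,b)$. (1) (Stochastic mapping.) Let $\Theta=\sum_{k\ge1}\theta_k\delta_{\psi_k}$ be a gamma process $\Gamma\mathrm P(\gamma,\alpha,0)$ with atoms $(\theta_k,\psi_k)_{k\ge 1}$ as above, and let $G_1,G_2,\dots$ be i.i.d. $\mathrm{Gam}(\alpha,\alpha)$,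 independent of $(\theta_k,\psi_k)_{k\ge1}$. Then $$\sum_{k\ge1}\frac{\theta_k}{\theta_k+G_k}\,\delta_{\psi_k}\sim\mathrm{BP}(\gamma,\alpha,0).$$ For fixed $\theta>0$ and $G\sim\mathrm{Gam}(\alpha,\alpha)$, the law of $\theta/(\theta+G)$ is $\kappa(\theta,du)=\mathrm{Gam}(\theta/u-\theta;\alpha,\alpha)\,\frac{\theta}{u^2}\,du$ on $(0,1)$. (2) (Series representation.) Let $(E_k)_{k\ge1}$ be i.i.d. $\mathrm{Exp}(\alpha\gamma)$, $(V_k)_{k\ge1}$ i.i.d. $\mathrm{Exp}(\alpha)$, $(G_k)_{k\ge1}$ i.i.d. $\mathrm{Gam}(\alpha,\alpha)$ and $(\psi_k)_{k\ge1}$ i.i.d. $H$, all mutually independent, and put $\Gamma_{k,\alpha\gamma}=E_1+\dots+E_k$. Then, for every $\alpha>0$ and $\gamma>0$, $$\sum_{k\ge1}\theta_k\,\delta_{\psi_k}\sim\mathrm{BP}(\gamma,\alpha,0),\qquad \theta_k=\bigl(1+G_kV_k^{-1}e^{\Gamma_{k,\alpha\gamma}}\bigr)^{-1}.$$ -/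

import Mathlib

open MeasureTheory ProbabilityTheory
open scoped ENNReal NNReal

noncomputable section

/-- `N` is a Poisson point process (viewed as a random measure) with rate measure `μ`: the number of
points in a measurable set `B` is Poisson with mean `μ B` (infinite almost surely if `μ B = ∞`), and
the numbers of points in finitely many disjoint measurable sets are independent. -/
structure IsPoissonProcess {Ω S : Type*} [MeasurableSpace Ω] [MeasurableSpace S]
    (N : Ω → Measure S) (μ : Measure S) (P : Measure Ω) : Prop where
  aemeasurable : AEMeasurable N P
  count_law : ∀ B : Set S, MeasurableSet B → μ B ≠ ∞ →
    P.map (fun ω => N ω B) = (poissonMeasure (μ B).toNNReal).map (fun n : ℕ => (n : ℝ≥0∞))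
  count_top : ∀ B : Set S, MeasurableSet B → μ B = ∞ → ∀ᵐ ω ∂P, N ω B = ∞
  indep : ∀ (n : ℕ) (B : Fin n → Set S), (∀ i, MeasurableSet (B i)) →
    Pairwise (fun i j => Disjoint (B i) (B j)) → iIndepFun (fun i ω => N ω (B i)) P

/-- The counting measure of the points `(θ k, ψ k)`, that is, `∑ₖ δ_{(θ k, ψ k)}`. -/
def pointMeasure {Ψ : Type*} [MeasurableSpace Ψ] (θ : ℕ → ℝ) (ψ : ℕ → Ψ) : Measure (ℝ × Ψ) :=
  Measure.sum fun k => Measure.dirac (θ k, ψ k)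

/-- The discrete measure `∑ₖ θ k δ_{ψ k}` with weights `θ k ≥ 0` and locations `ψ k`. -/
def weightedMeasure {Ψ : Type*} [MeasurableSpace Ψ] (θ : ℕ → ℝ) (ψ : ℕ → Ψ) : Measure Ψ :=
  Measure.sum fun k => ENNReal.ofReal (θ k) • Measure.dirac (ψ k)

/-- The measure `A ↦ ∫ θ 1_A(ψ) N(dθ, dψ)`, which turns `∑ₖ δ_{(θ k, ψ k)}` into
`∑ₖ θ k δ_{ψ k}`. -/
def collapse {Ψ : Type*} [MeasurableSpace Ψ] (N : Measure (ℝ × Ψ)) : Measure Ψ :=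
  (N.withDensity fun x => ENNReal.ofReal x.1).map Prod.snd

theorem collapse_pointMeasure {Ψ : Type*} [MeasurableSpace Ψ] (θ : ℕ → ℝ) (ψ : ℕ → Ψ) :
    collapse (pointMeasure θ ψ) = weightedMeasure θ ψ := by
  have hf : Measurable fun x : ℝ × Ψ => ENNReal.ofReal x.1 := by fun_prop
  ext A hA
  rw [collapse, Measure.map_apply measurable_snd hA, withDensity_apply _ (measurable_snd hA),
    pointMeasure, weightedMeasure, Measure.sum_apply _ hA,
    Measure.restrict_sum _ (measurable_snd hA), lintegral_sum_measure]
  refine tsum_congr fun k => ?_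
  rw [← lintegral_indicator (measurable_snd hA),
    lintegral_dirac' _ (hf.indicator (measurable_snd hA))]
  by_cases h : ψ k ∈ A <;> simp [h, hA, Set.indicator]

/-- The random measure `Θ` is distributed as the completely random measure with rate measure `ν` on
the positive reals and base distribution `H`: it is equal in law to `∫ θ N(dθ, ·)` for a Poisson
point process `N` with rate measure `ν × H` (taken on its canonical space). -/
def IsCRM {Ω Ψ : Type*} [MeasurableSpace Ω] [MeasurableSpace Ψ]
    (Θ : Ω → Measure Ψ) (ν : Measure ℝ) (H : Measure Ψ) (P : Measure Ω) : Prop :=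
  ∃ Q : Measure (Measure (ℝ × Ψ)), IsProbabilityMeasure Q ∧
    IsPoissonProcess (fun N => N) (ν.prod H) Q ∧ IdentDistrib Θ collapse P Q

/-- Rate measure of the gamma process with mass `γ`, rate parameter `lam` and discount `d`. -/
def gammaProcessRate (γ lam d : ℝ) : Measure ℝ :=
  (volume.restrict (Set.Ioi 0)).withDensity fun θ =>
    ENNReal.ofReal
      (γ * (lam ^ (1 - d) / Real.Gamma (1 - d)) * θ ^ (-1 - d) * Real.exp (-lam * θ))

/-- Rate measure of the beta process with mass `γ`, concentration `α` and discount `d`. -/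
def betaProcessRate (γ α d : ℝ) : Measure ℝ :=
  (volume.restrict (Set.Ioc 0 1)).withDensity fun θ =>
    ENNReal.ofReal
      (γ * (Real.Gamma (α + 1) / (Real.Gamma (1 - d) * Real.Gamma (α + d))) *
        θ ^ (-1 - d) * (1 - θ) ^ (α + d - 1))

end

/-! A Poisson process with rate measure μ is characterised by its Laplace functional: 𝔼 exp(-∫ f dN)
= exp(-∫ (1 - e^{-f}) dμ) for every measurable f with values in [0, ∞].
`IsPoissonProcess.hasPoissonLaplace` gives one direction by factorising over the fibres of simple
functions. The converse, `isPoissonProcess_of_hasPoissonLaplace`, rests on uniqueness of Laplace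
transforms on [0, ∞]^ι, where infinite counts are allowed. In this language, mapping the points
pushes μ forward, and independent marks of law ρ replace μ by μ × ρ (`hasPoissonLaplace_marks`).
Both parts thus become computations of a rate measure.

For (1), the gamma rate at θ times the density of u = θ/(θ + G) equals the beta rate at u times the
Gam(α, α/u) density at θ (`gammaProcessRate_mul_gammaPDF`). Integrating θ out leaves the beta rate.

For (2), the arrival times with their marks form a Poisson process (`hasPoissonLaplace_arrivals`).
This follows by iterating the one-step operator `arrivalOp`, which fixes the required exponential.
The map (t, v) ↦ v e^{-t} carries αγ dt × Exp(α) to the gamma process rate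
(`lintegral_expMeasure_mul_exp_neg`). With θ = V e^{-Γ}, the weight 1/(1 + G V⁻¹ e^Γ) equals θ/(θ +
G), so the rate computation of (1) finishes the proof. -/

/-! ### Exponential and logarithm on [0, ∞], and Poisson generating functions. -/

/-- The function `x ↦ e⁻ˣ` on `[0, ∞]`. -/
noncomputable def expNeg (x : ℝ≥0∞) : ℝ≥0∞ := EReal.exp (-(x : EReal))

@[simp] theorem expNeg_zero : expNeg 0 = 1 := by simp [expNeg]

@[simp] theorem expNeg_top : expNeg ∞ = 0 := by simp [expNeg]

theorem expNeg_ofReal {r : ℝ} (hr : 0 ≤ r) :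
    expNeg (ENNReal.ofReal r) = ENNReal.ofReal (Real.exp (-r)) := by
  rw [expNeg, EReal.coe_ennreal_ofReal, max_eq_left hr, ← EReal.coe_neg, EReal.exp_coe]

theorem continuous_expNeg : Continuous expNeg :=
  ENNReal.continuous_exp.comp (continuous_neg.comp continuous_coe_ennreal_ereal)

@[fun_prop] theorem measurable_expNeg : Measurable expNeg := continuous_expNeg.measurable

theorem expNeg_antitone : Antitone expNeg := fun x y h =>
  EReal.exp_monotone (EReal.neg_le_neg_iff.2 (by exact_mod_cast h))

theorem expNeg_injective : Function.Injective expNeg := fun x y h => by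
  have := EReal.exp_strictMono.injective h
  exact_mod_cast neg_injective this

theorem expNeg_le_one (x : ℝ≥0∞) : expNeg x ≤ 1 := by
  simpa using expNeg_antitone (zero_le (a := x))

theorem expNeg_ne_top (x : ℝ≥0∞) : expNeg x ≠ ∞ :=
  ((expNeg_le_one x).trans_lt ENNReal.one_lt_top).ne

theorem expNeg_eq_zero {x : ℝ≥0∞} : expNeg x = 0 ↔ x = ∞ := by
  rw [← expNeg_top, expNeg_injective.eq_iff]

theorem expNeg_eq_one {x : ℝ≥0∞} : expNeg x = 1 ↔ x = 0 := by
  rw [← expNeg_zero, expNeg_injective.eq_iff]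

theorem expNeg_add (x y : ℝ≥0∞) : expNeg (x + y) = expNeg x * expNeg y := by
  have h (z : ℝ≥0∞) : EReal.exp (z : EReal) ≠ 0 := by simp
  simp only [expNeg, EReal.exp_neg, EReal.coe_ennreal_add, EReal.exp_add]
  rw [ENNReal.mul_inv (Or.inl (h x)) (Or.inr (h y))]

theorem expNeg_sum {ι : Type*} (s : Finset ι) (f : ι → ℝ≥0∞) :
    expNeg (∑ i ∈ s, f i) = ∏ i ∈ s, expNeg (f i) := by
  classical
  induction s using Finset.induction_on with
  | empty => simp
  | insert a s ha ih => rw [Finset.sum_insert ha, Finset.prod_insert ha, expNeg_add, ih]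

theorem expNeg_nat_mul (n : ℕ) (x : ℝ≥0∞) : expNeg (n * x) = expNeg x ^ n := by
  have := expNeg_sum (Finset.range n) fun _ => x
  simpa using this

/-- The function `y ↦ -log y` on `[0, 1]`, with values in `[0, ∞]`. -/
noncomputable def negLog (y : ℝ≥0∞) : ℝ≥0∞ := (-(ENNReal.log y)).toENNReal

theorem expNeg_negLog {y : ℝ≥0∞} (hy : y ≤ 1) : expNeg (negLog y) = y := by
  have : 0 ≤ -ENNReal.log y := by
    rw [EReal.le_neg, neg_zero]; simpa using hy
  rw [expNeg, negLog, EReal.coe_toENNReal this, neg_neg, ENNReal.exp_log]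

@[fun_prop] theorem measurable_negLog : Measurable negLog := by
  unfold negLog
  exact measurable_ereal_toENNReal.comp
    (continuous_neg.measurable.comp ENNReal.continuous_log.measurable)

theorem tendsto_expNeg_tsum (a : ℕ → ℝ≥0∞) :
    Filter.Tendsto (fun n => ∏ k ∈ Finset.range n, expNeg (a k)) Filter.atTop
      (nhds (expNeg (∑' k, a k))) := by
  simp_rw [← expNeg_sum]
  exact (continuous_expNeg.tendsto _).comp (ENNReal.tendsto_nat_tsum a)

theorem lintegral_poissonMeasure_pow (r : ℝ≥0) {q : ℝ≥0∞} (hq : q ≤ 1) :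
    ∫⁻ n, q ^ n ∂poissonMeasure r = expNeg ((1 - q) * r) := by
  lift q to ℝ≥0 using (hq.trans_lt ENNReal.one_lt_top).ne
  have hq' : (q : ℝ) ≤ 1 := by exact_mod_cast hq
  have e : (1 - (q : ℝ≥0∞)) * r = ENNReal.ofReal ((1 - q) * r) := by
    rw [ENNReal.ofReal_mul (by linarith), ENNReal.ofReal_sub _ q.coe_nonneg]
    simp
  have h : HasSum (fun n : ℕ => Real.exp (-r) * r ^ n / n.factorial * q ^ n)
      (Real.exp (-((1 - q) * r))) := by
    convert! (NormedSpace.expSeries_div_hasSum_exp ((r : ℝ) * q)).mul_left (Real.exp (-r)) using 1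
    · ext n; rw [mul_pow]; ring
    · rw [← Real.exp_eq_exp_ℝ, ← Real.exp_add]; congr 1; ring
  rw [e, expNeg_ofReal (mul_nonneg (by linarith) r.coe_nonneg), poissonMeasure, lintegral_sum_measure,
    ← h.tsum_eq, ENNReal.ofReal_tsum_of_nonneg (fun n => by positivity) h.summable]
  refine tsum_congr fun n => ?_
  rw [lintegral_smul_measure, lintegral_dirac, ENNReal.ofReal_mul (by positivity),
    ENNReal.ofReal_pow q.coe_nonneg]
  simp

theorem lintegral_prod_eq_prod_lintegral_of_indepFun₀ {Ω ι : Type*} [MeasurableSpace Ω]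
    {P : Measure Ω} (s : Finset ι) (X : ι → Ω → ℝ≥0∞) (hX : iIndepFun X P)
    (hm : ∀ i, AEMeasurable (X i) P) :
    ∫⁻ ω, ∏ i ∈ s, X i ω ∂P = ∏ i ∈ s, ∫⁻ ω, X i ω ∂P := by
  have h := lintegral_prod_eq_prod_lintegral_of_indepFun s (fun i => (hm i).mk (X i))
    (hX.congr fun i => (hm i).ae_eq_mk) fun i => (hm i).measurable_mk
  have h1 : ∀ᵐ ω ∂P, ∀ i ∈ s, X i ω = (hm i).mk (X i) ω :=
    (ae_ball_iff s.countable_toSet).2 fun i _ => (hm i).ae_eq_mk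
  rw [lintegral_congr_ae (h1.mono fun ω hω => Finset.prod_congr rfl hω), h]
  exact Finset.prod_congr rfl fun i _ => (lintegral_congr_ae (hm i).ae_eq_mk).symm

/-! ### Laplace functional of a Poisson process. -/

section Laplace

variable {Ω S : Type*} [MeasurableSpace Ω] [MeasurableSpace S]

/-- The Laplace functional of the random measure `N` at `f` is that of a Poisson point process with
rate measure `μ`. -/
def HasPoissonLaplace (N : Ω → Measure S) (μ : Measure S) (P : Measure Ω) (f : S → ℝ≥0∞) : Prop :=
  ∫⁻ ω, expNeg (∫⁻ x, f x ∂N ω) ∂P = expNeg (∫⁻ x, (1 - expNeg (f x)) ∂μ)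

/-- Monotone convergence is used because μ may be infinite and no dominating function need exist. -/
theorem tendsto_lintegral_one_sub_expNeg (μ : Measure S) {f : ℕ → S → ℝ≥0∞} {g : S → ℝ≥0∞}
    (hf : ∀ n, Measurable (f n)) (hmono : Monotone f)
    (hlim : ∀ x, Filter.Tendsto (fun n => f n x) Filter.atTop (nhds (g x))) :
    Filter.Tendsto (fun n => ∫⁻ x, (1 - expNeg (f n x)) ∂μ) Filter.atTop
      (nhds (∫⁻ x, (1 - expNeg (g x)) ∂μ)) := by
  refine lintegral_tendsto_of_tendsto_of_monotone (fun n => by have := hf n; fun_prop)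
    (.of_forall fun x n m h => tsub_le_tsub_left (expNeg_antitone (hmono h x)) _)
    (.of_forall fun x => ?_)
  exact ENNReal.Tendsto.sub tendsto_const_nhds ((continuous_expNeg.tendsto _).comp (hlim x))
    (Or.inl ENNReal.one_ne_top)

theorem HasPoissonLaplace.of_tendsto {N : Ω → Measure S} {μ : Measure S} {P : Measure Ω}
    [IsFiniteMeasure P] (hN : AEMeasurable N P) {f : ℕ → S → ℝ≥0∞} {g : S → ℝ≥0∞}
    (hf : ∀ n, Measurable (f n)) (hmono : Monotone f)
    (hlim : ∀ x, Filter.Tendsto (fun n => f n x) Filter.atTop (nhds (g x)))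
    (h : ∀ n, HasPoissonLaplace N μ P (f n)) : HasPoissonLaplace N μ P g := by
  have h1 : Filter.Tendsto (fun n => ∫⁻ ω, expNeg (∫⁻ x, f n x ∂N ω) ∂P) Filter.atTop
      (nhds (∫⁻ ω, expNeg (∫⁻ x, g x ∂N ω) ∂P)) := by
    refine tendsto_lintegral_of_dominated_convergence' (fun _ => 1)
      (fun n => measurable_expNeg.comp_aemeasurable
        ((Measure.measurable_lintegral (hf n)).comp_aemeasurable hN))
      (fun n => .of_forall fun ω => expNeg_le_one _) (by simp) (.of_forall fun ω => ?_)
    exact (continuous_expNeg.tendsto _).comp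
      (lintegral_tendsto_of_tendsto_of_monotone (fun n => (hf n).aemeasurable)
        (.of_forall fun x n m h => hmono h x) (.of_forall hlim))
  refine tendsto_nhds_unique h1 ?_
  simp_rw [show ∀ n, _ = _ from h]
  exact (continuous_expNeg.tendsto _).comp (tendsto_lintegral_one_sub_expNeg μ hf hmono hlim)

theorem IsPoissonProcess.lintegral_expNeg_mul {N : Ω → Measure S} {μ : Measure S} {P : Measure Ω}
    [IsProbabilityMeasure P] (hN : IsPoissonProcess N μ P) {B : Set S} (hB : MeasurableSet B)
    (c : ℝ≥0∞) :
    ∫⁻ ω, expNeg (c * N ω B) ∂P = expNeg ((1 - expNeg c) * μ B) := by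
  by_cases h : μ B = ∞
  -- When the mass is infinite, both sides are 1 for c = 0 and both are 0 otherwise.
  · by_cases hc : c = 0
    · simp [hc]
    · have h1 : 1 - expNeg c ≠ 0 := by
        rw [Ne, tsub_eq_zero_iff_le, (expNeg_le_one c).ge_iff_eq, expNeg_eq_one]
        exact fun h => hc h
      rw [h, ENNReal.mul_top h1, expNeg_top,
        lintegral_congr_ae ((hN.count_top B hB h).mono fun ω hω =>
          show _ = (0 : ℝ≥0∞) by rw [hω, ENNReal.mul_top hc, expNeg_top])]
      simp
  · have hm : AEMeasurable (fun ω => N ω B) P :=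
      (Measure.measurable_coe hB).comp_aemeasurable hN.aemeasurable
    have h2 : ∫⁻ ω, expNeg (c * N ω B) ∂P =
        ∫⁻ y, expNeg (c * y) ∂P.map fun ω => N ω B :=
      (lintegral_map' (f := fun y => expNeg (c * y)) (by fun_prop) hm).symm
    rw [h2, hN.count_law B hB h, lintegral_map (by fun_prop) .of_discrete]
    simp_rw [mul_comm c, expNeg_nat_mul]
    rw [lintegral_poissonMeasure_pow _ (expNeg_le_one c), ENNReal.coe_toNNReal h]

/-- For simple f the integral is a finite combination of counts on the disjoint fibres. These counts
are independent, so the transform is a product of Poisson ones; monotone approximation does the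
rest. -/
theorem IsPoissonProcess.hasPoissonLaplace {N : Ω → Measure S} {μ : Measure S} {P : Measure Ω}
    [IsProbabilityMeasure P] (hN : IsPoissonProcess N μ P) {f : S → ℝ≥0∞} (hf : Measurable f) :
    HasPoissonLaplace N μ P f := by
  refine .of_tendsto hN.aemeasurable (f := fun n => SimpleFunc.eapprox f n)
    (fun n => SimpleFunc.measurable _) (SimpleFunc.monotone_eapprox f)
    (SimpleFunc.tendsto_eapprox hf) fun n => ?_
  generalize SimpleFunc.eapprox f n = g
  let e := g.range.equivFin
  let c : Fin g.range.card → ℝ≥0∞ := fun i => (e.symm i : ℝ≥0∞)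
  let B : Fin g.range.card → Set S := fun i => g ⁻¹' {c i}
  have hB : ∀ i, MeasurableSet (B i) := fun i => g.measurableSet_fiber _
  have hd : Pairwise fun i j => Disjoint (B i) (B j) := fun i j hij => by
    refine Disjoint.preimage _ (Set.disjoint_singleton.2 fun h => hij ?_)
    exact e.symm.injective (Subtype.ext h)
  have key (φ : ℝ≥0∞ → ℝ≥0∞) (m : Measure S) :
      ∫⁻ x, φ (g x) ∂m = ∑ i, φ (c i) * m (B i) := by
    have h1 : ∫⁻ x, φ (g x) ∂m = (g.map φ).lintegral m := by
      rw [← SimpleFunc.lintegral_eq_lintegral]; rfl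
    rw [h1, SimpleFunc.map_lintegral, ← Finset.sum_coe_sort, ← e.symm.sum_comp]
  have hm (i) : AEMeasurable (fun ω => N ω (B i)) P :=
    (Measure.measurable_coe (hB i)).comp_aemeasurable hN.aemeasurable
  unfold HasPoissonLaplace
  rw [key (fun y => 1 - expNeg y) μ, expNeg_sum]
  simp_rw [fun ω => key (fun y => y) (N ω), expNeg_sum]
  rw [lintegral_prod_eq_prod_lintegral_of_indepFun₀ _ (fun i ω => expNeg (c i * N ω (B i)))]
  · exact Finset.prod_congr rfl fun i _ => hN.lintegral_expNeg_mul (hB i) _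
  · exact (hN.indep _ B hB hd).comp (fun i y => expNeg (c i * y)) fun i => by fun_prop
  · exact fun i => measurable_expNeg.comp_aemeasurable ((hm i).const_mul _)

end Laplace

/-! ### Uniqueness of Laplace transforms on [0, ∞]^ι. -/

open scoped BoundedContinuousFunction in
/-- Finite measures on `[0, ∞]^ι` are determined by their Laplace transforms at integer points. -/
theorem ext_of_lintegral_prod_expNeg {ι : Type*} [Fintype ι] {μ ν : Measure (ι → ℝ≥0∞)}
    [IsFiniteMeasure μ] [IsFiniteMeasure ν]
    (h : ∀ m : ι → ℕ, ∫⁻ x, ∏ i, expNeg (x i) ^ m i ∂μ = ∫⁻ x, ∏ i, expNeg (x i) ^ m i ∂ν) :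
    μ = ν := by
  have hc : Continuous fun y => (expNeg y).toReal :=
    ENNReal.continuousOn_toReal.comp_continuous continuous_expNeg expNeg_ne_top
  let u : ι → (ι → ℝ≥0∞) →ᵇ ℝ := fun i =>
    BoundedContinuousFunction.mkOfCompact ⟨fun x => (expNeg (x i)).toReal, hc.comp (continuous_apply i)⟩
  have hu (i x) : u i x = (expNeg (x i)).toReal := rfl
  -- The algebra generated by the coordinate functions e^{-x_i} separates points, so its integrals
  -- determine a finite measure. It is spanned by monomials, whose integrals are the given
  -- transforms.
  let A : StarSubalgebra ℝ ((ι → ℝ≥0∞) →ᵇ ℝ) :=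
    { Algebra.adjoin ℝ (Set.range u) with
      star_mem' := fun {a} ha => by rwa [show star a = a by ext; simp] }
  have hA : ∀ g, g ∈ A ↔ g ∈ Algebra.adjoin ℝ (Set.range u) := fun g => Iff.rfl
  refine ext_of_forall_mem_subalgebra_integral_eq_of_polish (𝕜 := ℝ) (A := A) ?_ fun g hg => ?_
  · intro x y hxy
    obtain ⟨i, hi⟩ := Function.ne_iff.1 hxy
    refine ⟨_, ⟨_, ⟨u i, (hA _).2 (Algebra.subset_adjoin ⟨i, rfl⟩), rfl⟩, rfl⟩, ?_⟩
    change (expNeg (x i)).toReal ≠ (expNeg (y i)).toReal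
    rwa [Ne, ENNReal.toReal_eq_toReal_iff' (expNeg_ne_top _) (expNeg_ne_top _),
      expNeg_injective.eq_iff]
  · rw [hA, ← Subalgebra.mem_toSubmodule, Algebra.adjoin_eq_span] at hg
    induction hg using Submodule.span_induction with
    | mem g hg =>
      have : ∃ m : ι → ℕ, ∀ x, g x = ∏ i, (expNeg (x i)).toReal ^ m i := by
        classical
        induction hg using Submonoid.closure_induction with
        | mem g hg =>
          obtain ⟨i, rfl⟩ := hg
          refine ⟨Pi.single i 1, fun x => ?_⟩
          rw [Finset.prod_eq_single i] <;> simp +contextual [hu]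
        | one => exact ⟨0, by simp⟩
        | mul a b _ _ ha hb =>
          obtain ⟨m, hm⟩ := ha
          obtain ⟨k, hk⟩ := hb
          exact ⟨m + k, fun x => by simp [hm, hk, pow_add, Finset.prod_mul_distrib]⟩
      obtain ⟨m, hm⟩ := this
      have key (ρ : Measure (ι → ℝ≥0∞)) :
          ∫ x, g x ∂ρ = (∫⁻ x, ∏ i, expNeg (x i) ^ m i ∂ρ).toReal := by
        rw [← integral_toReal (Measurable.aemeasurable (by fun_prop)) (.of_forall fun x =>
          ENNReal.prod_lt_top fun i _ => ENNReal.pow_lt_top (expNeg_ne_top _).lt_top)]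
        simp [hm, ENNReal.toReal_prod]
      rw [key, key, h m]
    | zero => simp
    | add a b _ _ ha hb =>
      have hi (a : (ι → ℝ≥0∞) →ᵇ ℝ) (ρ : Measure (ι → ℝ≥0∞)) [IsFiniteMeasure ρ] :
        Integrable a ρ := a.integrable ρ
      simp only [BoundedContinuousFunction.coe_add, Pi.add_apply]
      rw [integral_add (hi a μ) (hi b μ), integral_add (hi a ν) (hi b ν), ha, hb]
    | smul c a _ ha =>
      simp only [BoundedContinuousFunction.coe_smul, integral_smul, ha]

/-! ### From the Laplace functional back to the Poisson process. -/

section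

variable {Ω S : Type*} [MeasurableSpace Ω] [MeasurableSpace S]

theorem lintegral_pi_prod_eq_prod_lintegral {ι : Type*} [Fintype ι] {E : ι → Type*}
    [∀ i, MeasurableSpace (E i)] (μ : ∀ i, Measure (E i)) [∀ i, IsProbabilityMeasure (μ i)]
    {f : ∀ i, E i → ℝ≥0∞} (hf : ∀ i, Measurable (f i)) :
    ∫⁻ x, ∏ i, f i (x i) ∂Measure.pi μ = ∏ i, ∫⁻ y, f i y ∂μ i := by
  refine (lintegral_prod_eq_prod_lintegral_of_indepFun _ (fun i (x : ∀ i, E i) => f i (x i))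
    (iIndepFun_pi fun i => (hf i).aemeasurable)
    fun i => (hf i).comp (measurable_pi_apply i)).trans ?_
  refine Finset.prod_congr rfl fun i _ => ?_
  rw [← (measurePreserving_eval μ i).map_eq, lintegral_map (hf i) (measurable_pi_apply i)]

/-- The Laplace functional is taken at f = ∑ m_i 1_{B_i}. By disjointness at most one term is
nonzero at each point, so 1 - e^{-f} is again a sum of indicators. -/
theorem lintegral_prod_expNeg_of_hasPoissonLaplace {N : Ω → Measure S} {μ : Measure S}
    {P : Measure Ω} (h : ∀ f, Measurable f → HasPoissonLaplace N μ P f) {ι : Type*} [Fintype ι]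
    {B : ι → Set S} (hB : ∀ i, MeasurableSet (B i))
    (hd : Pairwise fun i j => Disjoint (B i) (B j)) (m : ι → ℕ) :
    ∫⁻ ω, ∏ i, expNeg (N ω (B i)) ^ m i ∂P = ∏ i, expNeg ((1 - expNeg (m i)) * μ (B i)) := by
  have hm (i) : Measurable ((B i).indicator fun _ => (m i : ℝ≥0∞)) :=
    measurable_const.indicator (hB i)
  have h1 := h (fun x => ∑ i, (B i).indicator (fun _ => (m i : ℝ≥0∞)) x)
    (Finset.measurable_sum _ fun i _ => hm i)
  have h2 (x : S) : 1 - expNeg (∑ i, (B i).indicator (fun _ => (m i : ℝ≥0∞)) x) =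
      ∑ i, (B i).indicator (fun _ => 1 - expNeg (m i : ℝ≥0∞)) x := by
    by_cases hx : ∃ i, x ∈ B i
    · obtain ⟨i, hi⟩ := hx
      have hj (j) (hj : j ≠ i) : x ∉ B j := fun hxj => Set.disjoint_left.1 (hd hj) hxj hi
      rw [Finset.sum_eq_single i (fun j _ hji => Set.indicator_of_notMem (hj j hji) _) (by simp),
        Finset.sum_eq_single i (fun j _ hji => Set.indicator_of_notMem (hj j hji) _) (by simp)]
      simp [hi]
    · push Not at hx
      simp [hx]
  unfold HasPoissonLaplace at h1
  simp_rw [h2] at h1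
  rw [lintegral_finsetSum _ fun i _ => measurable_const.indicator (hB i)] at h1
  simp_rw [lintegral_finsetSum _ fun i _ => hm i, lintegral_indicator (hB _),
    setLIntegral_const, expNeg_sum, expNeg_nat_mul] at h1
  exact h1

theorem isPoissonProcess_of_hasPoissonLaplace {N : Ω → Measure S} {μ : Measure S}
    {P : Measure Ω} [IsProbabilityMeasure P] (hN : AEMeasurable N P)
    (h : ∀ f, Measurable f → HasPoissonLaplace N μ P f) : IsPoissonProcess N μ P := by
  have hm {B : Set S} (hB : MeasurableSet B) : AEMeasurable (fun ω => N ω B) P :=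
    (Measure.measurable_coe hB).comp_aemeasurable hN
  have one {B : Set S} (hB : MeasurableSet B) (m : ℕ) :
      ∫⁻ ω, expNeg (N ω B) ^ m ∂P = expNeg ((1 - expNeg m) * μ B) := by
    simpa using lintegral_prod_expNeg_of_hasPoissonLaplace h (ι := Unit) (B := fun _ => B)
      (fun _ => hB) (fun _ _ hij => (hij rfl).elim) fun _ => m
  refine ⟨hN, fun B hB hfin => ?_, fun B hB htop => ?_, fun n B hB hd => ?_⟩
  -- A single count is viewed as a vector indexed by `Unit`, so that the multivariate uniqueness
  -- theorem applies.
  · have hinj : Function.Injective fun (y : ℝ≥0∞) (_ : Unit) => y := fun a b h => congrFun h ()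
    have hme : MeasurableEmbedding fun (y : ℝ≥0∞) (_ : Unit) => y :=
      (MeasurableEquiv.funUnique Unit ℝ≥0∞).symm.measurableEmbedding
    have : IsProbabilityMeasure (P.map fun ω => N ω B) := Measure.isProbabilityMeasure_map (hm hB)
    refine hme.map_injective (ext_of_lintegral_prod_expNeg fun m => ?_)
    rw [hme.lintegral_map, hme.lintegral_map, lintegral_map' (Measurable.aemeasurable (by fun_prop)) (hm hB),
      lintegral_map (by fun_prop) .of_discrete]
    have e (n : ℕ) : expNeg (n : ℝ≥0∞) ^ m () = expNeg (m ()) ^ n := by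
      rw [← expNeg_nat_mul, ← expNeg_nat_mul, mul_comm]
    simp only [Finset.univ_unique, PUnit.default_eq_unit, Finset.prod_singleton, one hB, e]
    rw [lintegral_poissonMeasure_pow _ (expNeg_le_one _), ENNReal.coe_toNNReal hfin]
  -- Infinite rate makes 𝔼 e^{-N(B)} vanish, which forces N(B) = ∞ almost surely.
  · have h0 := one hB 1
    have h1 : 1 - expNeg ((1 : ℕ) : ℝ≥0∞) ≠ 0 := by
      rw [Ne, tsub_eq_zero_iff_le, (expNeg_le_one _).ge_iff_eq, expNeg_eq_one]
      simp
    have hmB : AEMeasurable (fun ω => expNeg (N ω B)) P :=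
      measurable_expNeg.comp_aemeasurable (hm hB)
    simp_rw [pow_one] at h0
    rw [htop, ENNReal.mul_top h1, expNeg_top, lintegral_eq_zero_iff' hmB] at h0
    filter_upwards [h0] with ω hω
    simpa [expNeg_eq_zero] using hω
  · have hpi : AEMeasurable (fun ω i => N ω (B i)) P := aemeasurable_pi_lambda _ fun i => hm (hB i)
    have this (i) : IsProbabilityMeasure (P.map fun ω => N ω (B i)) :=
      Measure.isProbabilityMeasure_map (hm (hB i))
    have : IsProbabilityMeasure (P.map fun ω i => N ω (B i)) := Measure.isProbabilityMeasure_map hpi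
    rw [iIndepFun_iff_map_fun_eq_pi_map fun i => hm (hB i)]
    refine ext_of_lintegral_prod_expNeg fun m => ?_
    rw [lintegral_map' (Measurable.aemeasurable (by fun_prop)) hpi, lintegral_prod_expNeg_of_hasPoissonLaplace h hB hd,
      lintegral_pi_prod_eq_prod_lintegral _ (f := fun i y => expNeg y ^ m i) fun i => by fun_prop]
    refine Finset.prod_congr rfl fun i _ => ?_
    rw [lintegral_map' (Measurable.aemeasurable (by fun_prop)) (hm (hB i)), one (hB i)]

/-! ### Canonical versions and completely random measures. -/

/-- `IsCRM` asks for a Poisson process on the space of measures itself. The law of N serves, since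
the defining conditions concern only the joint laws of counts. -/
theorem IsPoissonProcess.map_id {N : Ω → Measure S} {μ : Measure S} {P : Measure Ω}
    (hN : IsPoissonProcess N μ P) : IsPoissonProcess (fun M => M) μ (P.map N) := by
  have hmap {β : Type _} [MeasurableSpace β] {g : Measure S → β} (hg : Measurable g) :
      (P.map N).map g = P.map fun ω => g (N ω) :=
    AEMeasurable.map_map_of_aemeasurable hg.aemeasurable hN.aemeasurable
  refine ⟨aemeasurable_id, fun B hB hfin => ?_, fun B hB htop => ?_, fun n B hB hd => ?_⟩
  · rw [hmap (Measure.measurable_coe hB), hN.count_law B hB hfin]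
  · rw [ae_map_iff hN.aemeasurable
      (measurableSet_eq_fun (Measure.measurable_coe hB) measurable_const)]
    exact hN.count_top B hB htop
  · have := (hN.indep n B hB hd).isProbabilityMeasure
    have : IsProbabilityMeasure (P.map N) := Measure.isProbabilityMeasure_map hN.aemeasurable
    have hm (i) : Measurable fun M : Measure S => M (B i) := Measure.measurable_coe (hB i)
    rw [iIndepFun_iff_map_fun_eq_pi_map fun i => (hm i).aemeasurable,
      hmap (measurable_pi_lambda _ hm)]
    simp_rw [fun i => hmap (hm i)]
    exact (iIndepFun_iff_map_fun_eq_pi_map fun i =>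
      (hm i).comp_aemeasurable hN.aemeasurable).1 (hN.indep n B hB hd)

theorem measurable_collapse {Ψ : Type*} [MeasurableSpace Ψ] :
    Measurable (collapse : Measure (ℝ × Ψ) → Measure Ψ) := by
  have hf : Measurable fun x : ℝ × Ψ => ENNReal.ofReal x.1 := by fun_prop
  refine Measure.measurable_of_measurable_coe _ fun A hA => ?_
  have (N : Measure (ℝ × Ψ)) : collapse N A =
      ∫⁻ x, (Prod.snd ⁻¹' A).indicator (fun x => ENNReal.ofReal x.1) x ∂N := by
    rw [collapse, Measure.map_apply measurable_snd hA, withDensity_apply _ (measurable_snd hA),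
      lintegral_indicator (measurable_snd hA)]
  simp_rw [this]
  exact Measure.measurable_lintegral (hf.indicator (measurable_snd hA))

theorem IsPoissonProcess.isCRM_collapse {Ψ : Type*} [MeasurableSpace Ψ] {P : Measure Ω}
    [IsProbabilityMeasure P] {N : Ω → Measure (ℝ × Ψ)} {ν : Measure ℝ} {H : Measure Ψ}
    (hN : IsPoissonProcess N (ν.prod H) P) : IsCRM (fun ω => collapse (N ω)) ν H P :=
  ⟨P.map N, Measure.isProbabilityMeasure_map hN.aemeasurable, hN.map_id,
    measurable_collapse.comp_aemeasurable hN.aemeasurable, measurable_collapse.aemeasurable,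
    (AEMeasurable.map_map_of_aemeasurable measurable_collapse.aemeasurable hN.aemeasurable).symm⟩

end

/-! ### Point sequences: mapping and marking. -/

section

variable {Ω S M : Type*} [MeasurableSpace Ω] [MeasurableSpace S] [MeasurableSpace M]

/-- The counting measure of the points `x k`. -/
noncomputable def atoms (x : ℕ → S) : Measure S := Measure.sum fun k => Measure.dirac (x k)

theorem measurable_atoms : Measurable (atoms : (ℕ → S) → Measure S) := by
  refine Measure.measurable_of_measurable_coe _ fun B hB => ?_
  simp_rw [atoms, Measure.sum_apply _ hB]
  exact Measurable.tsum fun k =>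
    (Measure.measurable_coe hB).comp (Measure.measurable_dirac.comp (measurable_pi_apply k))

theorem lintegral_atoms (x : ℕ → S) {f : S → ℝ≥0∞} (hf : Measurable f) :
    ∫⁻ y, f y ∂atoms x = ∑' k, f (x k) := by
  rw [atoms, lintegral_sum_measure]
  exact tsum_congr fun k => lintegral_dirac' _ hf

theorem aemeasurable_atoms {P : Measure Ω} {X : ℕ → Ω → S} (hX : ∀ k, AEMeasurable (X k) P) :
    AEMeasurable (fun ω => atoms fun k => X k ω) P :=
  measurable_atoms.comp_aemeasurable (aemeasurable_pi_lambda _ hX)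

theorem hasPoissonLaplace_atoms_iff {P : Measure Ω} {X : ℕ → Ω → S} {μ : Measure S}
    {f : S → ℝ≥0∞} (hf : Measurable f) :
    HasPoissonLaplace (fun ω => atoms fun k => X k ω) μ P f ↔
      ∫⁻ ω, expNeg (∑' k, f (X k ω)) ∂P = expNeg (∫⁻ x, (1 - expNeg (f x)) ∂μ) := by
  simp_rw [HasPoissonLaplace, lintegral_atoms _ hf]

theorem hasPoissonLaplace_atoms_map {P : Measure Ω} {X : ℕ → Ω → S} {μ : Measure S} {T : S → M}
    (hT : Measurable T)
    (h : ∀ f, Measurable f → HasPoissonLaplace (fun ω => atoms fun k => X k ω) μ P f)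
    {f : M → ℝ≥0∞} (hf : Measurable f) :
    HasPoissonLaplace (fun ω => atoms fun k => T (X k ω)) (μ.map T) P f := by
  rw [hasPoissonLaplace_atoms_iff (X := fun k ω => T (X k ω)) hf, lintegral_map (by fun_prop) hT]
  exact (hasPoissonLaplace_atoms_iff (hf.comp hT)).1 (h _ (hf.comp hT))

theorem lintegral_comp_prodMk_of_indepFun {P : Measure Ω} [IsProbabilityMeasure P] {X : Ω → S}
    {U : Ω → M} (hX : AEMeasurable X P) (hU : AEMeasurable U P) (h : IndepFun X U P)
    {f : S × M → ℝ≥0∞} (hf : Measurable f) :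
    ∫⁻ ω, f (X ω, U ω) ∂P = ∫⁻ ω, ∫⁻ u, f (X ω, u) ∂P.map U ∂P := by
  have : IsProbabilityMeasure (P.map X) := Measure.isProbabilityMeasure_map hX
  have : IsProbabilityMeasure (P.map U) := Measure.isProbabilityMeasure_map hU
  rw [← lintegral_map' (f := f) hf.aemeasurable (hX.prodMk hU),
    (indepFun_iff_map_prod_eq_prod_map_map hX hU).1 h, lintegral_prod _ hf.aemeasurable,
    lintegral_map' hf.lintegral_prod_right'.aemeasurable hX]

theorem tendsto_lintegral_prod_expNeg {P : Measure Ω} [IsProbabilityMeasure P] {X : ℕ → Ω → S}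
    (hX : ∀ k, AEMeasurable (X k) P) {f : S → ℝ≥0∞} (hf : Measurable f) :
    Filter.Tendsto (fun n => ∫⁻ ω, ∏ k ∈ Finset.range n, expNeg (f (X k ω)) ∂P) Filter.atTop
      (nhds (∫⁻ ω, expNeg (∑' k, f (X k ω)) ∂P)) := by
  refine tendsto_lintegral_of_dominated_convergence' (fun _ => 1) (fun n => ?_)
    (fun n => .of_forall fun ω => Finset.prod_le_one' fun k _ => expNeg_le_one _) (by simp)
    (.of_forall fun ω => tendsto_expNeg_tsum _)
  exact Finset.aemeasurable_fun_prod _ fun k _ =>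
    (measurable_expNeg.comp hf).comp_aemeasurable (hX k)

/-- Given the points, the marks are independent, so each mark averages separately and e^{-f(x, U)}
becomes ∫ e^{-f(x, u)} ρ(du). The logarithm puts this product back into Laplace form, with the value
∞ where the average is 0. -/
theorem lintegral_expNeg_tsum_marks {P : Measure Ω} [IsProbabilityMeasure P] {X : ℕ → Ω → S}
    {U : ℕ → Ω → M} {ρ : Measure M} [SFinite ρ] (hX : ∀ k, AEMeasurable (X k) P)
    (hU : ∀ k, HasLaw (U k) ρ P) (hUi : iIndepFun U P)
    (hXU : IndepFun (fun ω k => X k ω) (fun ω k => U k ω) P) {f : S × M → ℝ≥0∞}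
    (hf : Measurable f) :
    ∫⁻ ω, expNeg (∑' k, f (X k ω, U k ω)) ∂P =
      ∫⁻ ω, expNeg (∑' k, negLog (∫⁻ u, expNeg (f (X k ω, u)) ∂ρ)) ∂P := by
  have hρ : IsProbabilityMeasure ρ := by
    rw [← (hU 0).map_eq]; exact Measure.isProbabilityMeasure_map (hU 0).aemeasurable
  have hle (x : S) : ∫⁻ u, expNeg (f (x, u)) ∂ρ ≤ 1 :=
    (lintegral_mono fun u => expNeg_le_one _).trans_eq (by simp)
  have hg : Measurable fun x => negLog (∫⁻ u, expNeg (f (x, u)) ∂ρ) :=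
    measurable_negLog.comp (measurable_expNeg.comp hf).lintegral_prod_right'
  -- Independence factorises finite products only; both sides are limits of their first n factors.
  refine tendsto_nhds_unique
    (tendsto_lintegral_prod_expNeg (fun k => (hX k).prodMk (hU k).aemeasurable) hf) ?_
  convert! tendsto_lintegral_prod_expNeg hX hg using 2 with n
  have hm : Measurable fun p : (ℕ → S) × (ℕ → M) =>
      ∏ k ∈ Finset.range n, expNeg (f (p.1 k, p.2 k)) := by fun_prop
  have hU' : AEMeasurable (fun ω k => U k ω) P :=
    aemeasurable_pi_lambda _ fun k => (hU k).aemeasurable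
  rw [lintegral_comp_prodMk_of_indepFun (aemeasurable_pi_lambda _ hX) hU' hXU hm]
  refine lintegral_congr fun ω => ?_
  have hfx (x : S) : Measurable fun u => expNeg (f (x, u)) := by fun_prop
  have hm' : Measurable fun u : ℕ → M => ∏ k ∈ Finset.range n, expNeg (f (X k ω, u k)) := by
    fun_prop
  refine (lintegral_map' hm'.aemeasurable hU').trans ?_
  refine (lintegral_prod_eq_prod_lintegral_of_indepFun₀ _
    (fun k ω' => expNeg (f (X k ω, U k ω'))) (hUi.comp (fun k u => expNeg (f (X k ω, u)))
      fun k => hfx _) fun k => (hfx _).comp_aemeasurable (hU k).aemeasurable).trans ?_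
  refine Finset.prod_congr rfl fun k _ => ?_
  rw [expNeg_negLog (hle _), ← (hU k).map_eq,
    lintegral_map' (hfx _).aemeasurable (hU k).aemeasurable]

theorem one_sub_lintegral_expNeg (ρ : Measure M) [IsProbabilityMeasure ρ] {f : M → ℝ≥0∞}
    (hf : Measurable f) :
    1 - ∫⁻ u, expNeg (f u) ∂ρ = ∫⁻ u, (1 - expNeg (f u)) ∂ρ := by
  have h1 : ∫⁻ u, expNeg (f u) ∂ρ ≠ ∞ :=
    ((lintegral_mono fun u => expNeg_le_one _).trans_lt (by simp)).ne
  rw [lintegral_sub (by fun_prop) h1 (.of_forall fun u => expNeg_le_one _)]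
  simp

/-- The marking theorem, in terms of Laplace functionals. -/
theorem hasPoissonLaplace_marks {P : Measure Ω} [IsProbabilityMeasure P] {X : ℕ → Ω → S}
    {U : ℕ → Ω → M} {μ : Measure S} {ρ : Measure M} [IsProbabilityMeasure ρ]
    (hX : ∀ k, AEMeasurable (X k) P) (hU : ∀ k, HasLaw (U k) ρ P) (hUi : iIndepFun U P)
    (hXU : IndepFun (fun ω k => X k ω) (fun ω k => U k ω) P)
    (h : ∀ f, Measurable f → HasPoissonLaplace (fun ω => atoms fun k => X k ω) μ P f)
    {f : S × M → ℝ≥0∞} (hf : Measurable f) :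
    HasPoissonLaplace (fun ω => atoms fun k => (X k ω, U k ω)) (μ.prod ρ) P f := by
  have hle (x : S) : ∫⁻ u, expNeg (f (x, u)) ∂ρ ≤ 1 :=
    (lintegral_mono fun u => expNeg_le_one _).trans_eq (by simp)
  have hg : Measurable fun x => negLog (∫⁻ u, expNeg (f (x, u)) ∂ρ) :=
    measurable_negLog.comp (measurable_expNeg.comp hf).lintegral_prod_right'
  rw [hasPoissonLaplace_atoms_iff (X := fun k ω => (X k ω, U k ω)) hf,
    lintegral_expNeg_tsum_marks hX hU hUi hXU hf, (hasPoissonLaplace_atoms_iff hg).1 (h _ hg),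
    lintegral_prod _ (by fun_prop)]
  congr 1
  refine lintegral_congr fun x => ?_
  rw [expNeg_negLog (hle x), one_sub_lintegral_expNeg ρ (by fun_prop)]

end

/-! ### Integrating b · exp(-∫ b). -/

theorem abs_exp_neg_sub_exp_neg_le {x y : ℝ} (hx : 0 ≤ x) (hy : 0 ≤ y) :
    |Real.exp (-x) - Real.exp (-y)| ≤ |x - y| := by
  wlog h : x ≤ y generalizing x y
  · rw [abs_sub_comm, abs_sub_comm x]
    exact this hy hx (le_of_not_ge h)
  have h1 : Real.exp (-y) ≤ Real.exp (-x) := Real.exp_le_exp.2 (by linarith)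
  have h2 : Real.exp (-x) ≤ 1 := Real.exp_le_one_iff.2 (by linarith)
  have h3 := Real.add_one_le_exp (x - y)
  have h4 : Real.exp (-y) = Real.exp (-x) * Real.exp (x - y) := by
    rw [← Real.exp_add]; congr 1; ring
  rw [abs_of_nonneg (by linarith), abs_of_nonpos (by linarith), h4]
  nlinarith [Real.exp_pos (-x)]

/-- The fundamental theorem of calculus for `exp (-∫ b)` with `b` bounded and measurable. -/
theorem integral_mul_exp_neg_integral {b : ℝ → ℝ} (hb : Measurable b) {C : ℝ}
    (h0 : ∀ x, 0 ≤ b x) (hC : ∀ x, b x ≤ C) {s t : ℝ} (hst : s ≤ t) :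
    ∫ y in s..t, b y * Real.exp (-∫ z in s..y, b z) = 1 - Real.exp (-∫ z in s..t, b z) := by
  have hint (x y : ℝ) : IntervalIntegrable b volume x y := by
    refine (intervalIntegrable_const (c := C)).mono_fun hb.aestronglyMeasurable
      (.of_forall fun x => ?_)
    simp only [Real.norm_eq_abs, abs_of_nonneg (h0 x)]
    exact (hC x).trans (le_abs_self C)
  have hlip : LipschitzOnWith C.toNNReal (fun y => Real.exp (-∫ z in s..y, b z))
      (Set.uIcc s t) := by
    refine LipschitzOnWith.of_dist_le_mul fun x hx y hy => ?_
    rw [Set.uIcc_of_le hst] at hx hy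
    rw [Real.dist_eq, Real.coe_toNNReal _ ((h0 0).trans (hC 0)), Real.dist_eq]
    refine (abs_exp_neg_sub_exp_neg_le
      (intervalIntegral.integral_nonneg hx.1 fun z _ => h0 z)
      (intervalIntegral.integral_nonneg hy.1 fun z _ => h0 z)).trans ?_
    rw [intervalIntegral.integral_interval_sub_left (hint _ _) (hint _ _)]
    rw [← Real.norm_eq_abs (∫ z in y..x, b z)]
    refine intervalIntegral.norm_integral_le_of_norm_le_const fun z _ => ?_
    rw [Real.norm_eq_abs, abs_of_nonneg (h0 z)]
    exact hC z
  -- As b is merely measurable, its primitive is differentiable only almost everywhere. The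
  -- Lipschitz bound gives absolute continuity, which is enough for the fundamental theorem.
  have key := hlip.absolutelyContinuousOnInterval.integral_deriv_eq_sub
  have h1 : ∫ y in s..t, deriv (fun y => Real.exp (-∫ z in s..y, b z)) y =
      ∫ y in s..t, -(b y * Real.exp (-∫ z in s..y, b z)) := by
    refine intervalIntegral.integral_congr_ae ?_
    filter_upwards [(hint s t).ae_hasDerivAt_integral] with y hy hys
    have := (hy (Set.uIoc_subset_uIcc hys) s Set.left_mem_uIcc).fun_neg.exp.deriv
    rw [this]; ring
  rw [h1, intervalIntegral.integral_neg, intervalIntegral.integral_same] at key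
  simp only [neg_zero, Real.exp_zero] at key
  linarith

theorem tendsto_setLIntegral_Ioc (f : ℝ → ℝ≥0∞) (s : ℝ) :
    Filter.Tendsto (fun n : ℕ => ∫⁻ y in Set.Ioc s (s + n), f y) Filter.atTop
      (nhds (∫⁻ y in Set.Ioi s, f y)) := by
  have hU : ⋃ n : ℕ, Set.Ioc s (s + n) = Set.Ioi s := by
    ext y
    simp only [Set.mem_iUnion, Set.mem_Ioc, Set.mem_Ioi]
    refine ⟨fun ⟨_, h, _⟩ => h, fun h => ?_⟩
    obtain ⟨n, hn⟩ := exists_nat_ge (y - s)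
    exact ⟨n, h, by linarith⟩
  have hmono : Monotone fun n : ℕ => Set.Ioc s (s + n) := fun n m h =>
    Set.Ioc_subset_Ioc_right (by have : (n : ℝ) ≤ m := by exact_mod_cast h
                                 linarith)
  have h1 (A : Set ℝ) (hA : MeasurableSet A) :
      ∫⁻ y in A, f y = (volume.withDensity f) A := (withDensity_apply _ hA).symm
  simp_rw [h1 _ measurableSet_Ioc, h1 _ measurableSet_Ioi, ← hU]
  exact tendsto_measure_iUnion_atTop hmono

theorem setLIntegral_Ioc_mul_expNeg {b : ℝ → ℝ≥0∞} (hb : Measurable b) {C : ℝ≥0}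
    (hC : ∀ x, b x ≤ C) {s t : ℝ} (hst : s ≤ t) :
    ∫⁻ y in Set.Ioc s t, b y * expNeg (∫⁻ z in Set.Ioc s y, b z) =
      1 - expNeg (∫⁻ z in Set.Ioc s t, b z) := by
  have hfin (x) : b x ≠ ∞ := ((hC x).trans_lt ENNReal.coe_lt_top).ne
  set β : ℝ → ℝ := fun x => (b x).toReal with hβ
  have hbβ (x) : b x = ENNReal.ofReal (β x) := (ENNReal.ofReal_toReal (hfin x)).symm
  have hβm : Measurable β := hb.ennreal_toReal
  have h0 (x) : 0 ≤ β x := ENNReal.toReal_nonneg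
  have hβC (x) : β x ≤ C := ENNReal.toReal_le_coe_of_le_coe (hC x)
  have hint (x y : ℝ) : IntegrableOn β (Set.Ioc x y) := by
    refine Integrable.mono (g := fun _ => (C : ℝ)) (integrable_const _) hβm.aestronglyMeasurable
      (.of_forall fun x => ?_)
    simp only [Real.norm_eq_abs, abs_of_nonneg (h0 x)]
    exact (hβC x).trans (le_abs_self _)
  have hI {y : ℝ} (hy : s ≤ y) : expNeg (∫⁻ z in Set.Ioc s y, b z) =
      ENNReal.ofReal (Real.exp (-∫ z in s..y, β z)) := by
    simp_rw [hbβ]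
    rw [← ofReal_integral_eq_lintegral_ofReal (hint s y) (.of_forall h0),
      expNeg_ofReal (integral_nonneg h0), intervalIntegral.integral_of_le hy]
  have hle {y : ℝ} (hy : s ≤ y) : Real.exp (-∫ z in s..y, β z) ≤ 1 :=
    Real.exp_le_one_iff.2 (neg_nonpos.2 (intervalIntegral.integral_nonneg hy fun z _ => h0 z))
  have h1 : ∫⁻ y in Set.Ioc s t, b y * expNeg (∫⁻ z in Set.Ioc s y, b z) =
      ∫⁻ y in Set.Ioc s t, ENNReal.ofReal (β y * Real.exp (-∫ z in s..y, β z)) := by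
    refine setLIntegral_congr_fun measurableSet_Ioc fun y hy => ?_
    rw [hI hy.1.le, hbβ, ← ENNReal.ofReal_mul (h0 y)]
  have hcont : ContinuousOn (fun y => Real.exp (-∫ z in s..y, β z)) (Set.Icc s t) := by
    refine Real.continuous_exp.comp_continuousOn (ContinuousOn.neg ?_)
    have := intervalIntegral.continuousOn_primitive_interval (μ := volume) (f := β) (a := s) (b := t)
      (by rw [Set.uIcc_of_le hst, integrableOn_Icc_iff_integrableOn_Ioc]; exact hint s t)
    rwa [Set.uIcc_of_le hst] at this
  have hint2 : IntegrableOn (fun y => β y * Real.exp (-∫ z in s..y, β z)) (Set.Ioc s t) := by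
    refine Integrable.mono (hint s t) (hβm.aestronglyMeasurable.mul
      ((hcont.mono Set.Ioc_subset_Icc_self).aestronglyMeasurable measurableSet_Ioc)) ?_
    refine (ae_restrict_iff' measurableSet_Ioc).2 (.of_forall fun y hy => ?_)
    rw [norm_mul]
    refine mul_le_of_le_one_right (norm_nonneg _) ?_
    rw [Real.norm_eq_abs, abs_of_pos (Real.exp_pos _)]
    exact hle hy.1.le
  rw [h1, ← ofReal_integral_eq_lintegral_ofReal hint2
    (.of_forall fun y => mul_nonneg (h0 y) (Real.exp_pos _).le),
    ← intervalIntegral.integral_of_le hst, integral_mul_exp_neg_integral hβm h0 hβC hst, hI hst,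
    ENNReal.ofReal_sub _ (Real.exp_pos _).le, ENNReal.ofReal_one]

theorem setLIntegral_Ioi_mul_expNeg {b : ℝ → ℝ≥0∞} (hb : Measurable b) {C : ℝ≥0}
    (hC : ∀ x, b x ≤ C) (s : ℝ) :
    ∫⁻ y in Set.Ioi s, b y * expNeg (∫⁻ z in Set.Ioc s y, b z) =
      1 - expNeg (∫⁻ z in Set.Ioi s, b z) := by
  refine tendsto_nhds_unique (tendsto_setLIntegral_Ioc _ s) ?_
  simp_rw [fun n : ℕ => setLIntegral_Ioc_mul_expNeg hb hC
    (show s ≤ s + n by have := n.cast_nonneg (α := ℝ); linarith)]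
  exact ENNReal.Tendsto.sub tendsto_const_nhds
    ((continuous_expNeg.tendsto _).comp (tendsto_setLIntegral_Ioc b s)) (Or.inl ENNReal.one_ne_top)

/-! ### Gamma and exponential integrals. -/

theorem measurable_gammaPDF (a r : ℝ) : Measurable (gammaPDF a r) :=
  (measurable_gammaPDFReal a r).ennreal_ofReal

theorem lintegral_gammaMeasure (a r : ℝ) {g : ℝ → ℝ≥0∞} (hg : Measurable g) :
    ∫⁻ x, g x ∂gammaMeasure a r = ∫⁻ x in Set.Ioi 0, gammaPDF a r x * g x := by
  rw [gammaMeasure, lintegral_withDensity_eq_lintegral_mul _ (measurable_gammaPDF a r) hg, setLIntegral_congr Ioi_ae_eq_Ici,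
    ← lintegral_indicator measurableSet_Ici]
  refine lintegral_congr fun x => ?_
  by_cases hx : 0 ≤ x
  · rw [Set.indicator_of_mem (Set.mem_Ici.2 hx), Pi.mul_apply]
  · rw [Set.indicator_of_notMem (show x ∉ Set.Ici 0 from hx), Pi.mul_apply, gammaPDF_of_neg (not_le.1 hx),
      zero_mul]

theorem lintegral_expMeasure {c : ℝ} (hc : 0 < c) {g : ℝ → ℝ≥0∞} (hg : Measurable g) :
    ∫⁻ x, g x ∂expMeasure c =
      ∫⁻ x in Set.Ioi 0, ENNReal.ofReal c * expNeg (ENNReal.ofReal (c * x)) * g x := by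
  rw [expMeasure, lintegral_gammaMeasure 1 c hg]
  refine setLIntegral_congr_fun measurableSet_Ioi fun x hx => ?_
  have h : gammaPDF 1 c x = exponentialPDF c x := rfl
  rw [h, exponentialPDF_of_nonneg (le_of_lt hx),
    expNeg_ofReal (mul_nonneg hc.le (le_of_lt hx)), ENNReal.ofReal_mul hc.le]

theorem ae_pos_expMeasure {c : ℝ} (hc : 0 < c) : ∀ᵐ x ∂expMeasure c, 0 < x := by
  have hs : MeasurableSet {x : ℝ | ¬ 0 < x} :=
    (measurableSet_lt measurable_const measurable_id).compl
  rw [ae_iff, ← lintegral_indicator_one hs,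
    lintegral_expMeasure hc (measurable_one.indicator hs)]
  refine (setLIntegral_congr_fun measurableSet_Ioi fun x hx => ?_).trans lintegral_zero
  rw [Set.indicator_of_notMem (not_not_intro hx), mul_zero]

theorem expMeasure_Iio_lt_one {c : ℝ} (hc : 0 < c) {T : ℝ} (hT : 0 ≤ T) :
    expMeasure c (Set.Iio T) < 1 := by
  have := isProbabilityMeasure_expMeasure hc
  refine (measure_mono Set.Iio_subset_Iic_self).trans_lt ?_
  rw [← ofReal_cdf, cdf_expMeasure_eq hc, if_pos hT, ENNReal.ofReal_lt_one]
  linarith [Real.exp_pos (-(c * T))]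

theorem setLIntegral_Ioi_const_add (s : ℝ) (f : ℝ → ℝ≥0∞) :
    ∫⁻ x in Set.Ioi 0, f (s + x) = ∫⁻ y in Set.Ioi s, f y := by
  rw [← (measurePreserving_add_left volume s).setLIntegral_comp_preimage_emb
    (measurableEmbedding_addLeft s) f (Set.Ioi s)]
  simp

/-! ### The one-step arrival operator and its iterates. -/

/-- The operator `φ ↦ (s ↦ 𝔼[η(s + E) φ(s + E)])`, where `E` is exponential with rate `c`. -/
noncomputable def arrivalOp (c : ℝ) (η φ : ℝ → ℝ≥0∞) (s : ℝ) : ℝ≥0∞ :=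
  ∫⁻ x, η (s + x) * φ (s + x) ∂expMeasure c

theorem measurable_arrivalOp {c : ℝ} (hc : 0 < c) {η φ : ℝ → ℝ≥0∞} (hη : Measurable η)
    (hφ : Measurable φ) : Measurable (arrivalOp c η φ) := by
  have := isProbabilityMeasure_expMeasure hc
  have h : Measurable fun p : ℝ × ℝ => η (p.1 + p.2) * φ (p.1 + p.2) := by fun_prop
  exact h.lintegral_prod_right'

theorem arrivalOp_mono (c : ℝ) (η : ℝ → ℝ≥0∞) : Monotone (arrivalOp c η) := fun _ _ h s =>
  lintegral_mono fun x => mul_le_mul_right (h (s + x)) _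

theorem setLIntegral_Ioi_eq_add (f : ℝ → ℝ≥0∞) {s y : ℝ} (h : s ≤ y) :
    ∫⁻ z in Set.Ioi s, f z = (∫⁻ z in Set.Ioc s y, f z) + ∫⁻ z in Set.Ioi y, f z := by
  rw [← Set.Ioc_union_Ioi_eq_Ioi h, lintegral_union measurableSet_Ioi]
  exact Set.disjoint_left.2 fun x hx hx' => not_lt.2 hx.2 hx'

/-- Write R(s) for the candidate. For y ≥ s, e^{-c(y-s)} R(y) = exp(-∫_s^y cη) R(s), so the operator
multiplies R(s) by ∫_s^∞ cη exp(-∫_s^y cη) dy = 1 - exp(-∫_s^∞ cη). This factor is 1 because η = 1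
beyond T makes the last integral infinite. -/
theorem arrivalOp_expNeg_eq {c : ℝ} (hc : 0 < c) {η : ℝ → ℝ≥0∞} (hη : Measurable η)
    (hη1 : ∀ t, η t ≤ 1) {T : ℝ} (hT : ∀ t, T < t → η t = 1) :
    arrivalOp c η (fun s => expNeg (ENNReal.ofReal c * ∫⁻ y in Set.Ioi s, (1 - η y))) =
      fun s => expNeg (ENNReal.ofReal c * ∫⁻ y in Set.Ioi s, (1 - η y)) := by
  set K := ENNReal.ofReal c with hK
  set R : ℝ → ℝ≥0∞ := fun s => expNeg (K * ∫⁻ y in Set.Ioi s, (1 - η y)) with hR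
  have hRm : Measurable R := by
    have : Antitone fun s => ∫⁻ y in Set.Ioi s, (1 - η y) := fun a b h =>
      lintegral_mono_set (Set.Ioi_subset_Ioi h)
    exact measurable_expNeg.comp (this.measurable.const_mul K)
  have hbm : Measurable fun y => K * η y := hη.const_mul K
  funext s
  have h1 {y : ℝ} (hy : s ≤ y) : expNeg (ENNReal.ofReal (c * (y - s))) * R y =
      expNeg (∫⁻ z in Set.Ioc s y, K * η z) * R s := by
    have e1 : ENNReal.ofReal (c * (y - s)) =
        (∫⁻ z in Set.Ioc s y, K * η z) + K * ∫⁻ z in Set.Ioc s y, (1 - η z) := by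
      rw [lintegral_const_mul _ hη, ← mul_add, ← lintegral_add_left hη]
      simp_rw [add_tsub_cancel_of_le (hη1 _)]
      rw [setLIntegral_one, Real.volume_Ioc, ENNReal.ofReal_mul hc.le]
    rw [e1, ← expNeg_add, ← expNeg_add, setLIntegral_Ioi_eq_add (fun y => 1 - η y) hy]
    congr 1; ring
  have h2 : ∫⁻ y in Set.Ioi s, K * η y = ∞ := by
    refine top_le_iff.1 ?_
    calc ∞ = ∫⁻ y in Set.Ioi (max s T), K := by
          rw [setLIntegral_const, Real.volume_Ioi, ENNReal.mul_top (by simpa [hK] using hc)]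
      _ = ∫⁻ y in Set.Ioi (max s T), K * η y :=
          setLIntegral_congr_fun measurableSet_Ioi fun y hy => by
            rw [hT y ((le_max_right s T).trans_lt hy), mul_one]
      _ ≤ _ := lintegral_mono_set (Set.Ioi_subset_Ioi (le_max_left s T))
  calc arrivalOp c η R s
      = ∫⁻ x in Set.Ioi 0, K * expNeg (ENNReal.ofReal (c * (s + x - s))) *
          (η (s + x) * R (s + x)) := by
        rw [arrivalOp, lintegral_expMeasure hc (by fun_prop)]
        simp_rw [add_sub_cancel_left, hK]
    _ = ∫⁻ y in Set.Ioi s, K * expNeg (ENNReal.ofReal (c * (y - s))) * (η y * R y) :=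
        setLIntegral_Ioi_const_add s
          fun y => K * expNeg (ENNReal.ofReal (c * (y - s))) * (η y * R y)
    _ = ∫⁻ y in Set.Ioi s, (K * η y * expNeg (∫⁻ z in Set.Ioc s y, K * η z)) * R s := by
        refine setLIntegral_congr_fun measurableSet_Ioi fun y hy => ?_
        have := h1 (le_of_lt hy)
        calc _ = K * η y * (expNeg (ENNReal.ofReal (c * (y - s))) * R y) := by ring
          _ = _ := by rw [this]; ring
    _ = R s := by
        rw [lintegral_mul_const' _ _ (expNeg_ne_top _), setLIntegral_Ioi_mul_expNeg hbm
          (C := Real.toNNReal c) (fun y => mul_le_of_le_one_right' (hη1 y)) s, h2]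
        simp [hR]

/-- The iterates are squeezed between the fixed point R and R + qⁿ. The lower bound is monotonicity
from R ≤ 1. The error survives n steps only if every arrival precedes T, hence every gap is shorter
than T, and q < 1 is the probability of one such gap. -/
theorem tendsto_iterate_arrivalOp {c : ℝ} (hc : 0 < c) {η : ℝ → ℝ≥0∞} (hη : Measurable η)
    (hη1 : ∀ t, η t ≤ 1) {T : ℝ} (hT0 : 0 ≤ T) (hT : ∀ t, T < t → η t = 1) :
    Filter.Tendsto (fun n => (arrivalOp c η)^[n] (fun _ => 1) 0) Filter.atTop
      (nhds (expNeg (ENNReal.ofReal c * ∫⁻ y in Set.Ioi 0, (1 - η y)))) := by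
  have hfix := arrivalOp_expNeg_eq hc hη hη1 hT
  set R : ℝ → ℝ≥0∞ := fun s => expNeg (ENNReal.ofReal c * ∫⁻ y in Set.Ioi s, (1 - η y)) with hR
  have hprob := isProbabilityMeasure_expMeasure hc
  set q := expMeasure c (Set.Iio T) with hq
  have hlow (n : ℕ) : R ≤ (arrivalOp c η)^[n] fun _ => 1 := by
    induction n with
    | zero => exact fun s => expNeg_le_one _
    | succ n ih =>
      rw [Function.iterate_succ_apply', ← hfix]
      exact arrivalOp_mono c η ih
  -- For s ≥ 0, s + x < T forces x < T; once s ≥ T, a positive gap can never return below T.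
  have hind (s : ℝ) (hs : 0 ≤ s) : ∫⁻ x, (Set.Iio T).indicator (fun _ => 1) (s + x) ∂expMeasure c ≤
      q * (Set.Iio T).indicator (fun _ => 1) s := by
    by_cases hsT : s < T
    · rw [Set.indicator_of_mem (Set.mem_Iio.2 hsT), mul_one, hq,
        ← lintegral_indicator_one measurableSet_Iio]
      refine lintegral_mono fun x => ?_
      by_cases hx : s + x < T
      · rw [Set.indicator_of_mem (Set.mem_Iio.2 hx), Set.indicator_of_mem]
        · rfl
        · exact Set.mem_Iio.2 (by linarith)
      · rw [Set.indicator_of_notMem (show s + x ∉ Set.Iio T from hx)]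
        exact zero_le
    · refine (lintegral_congr_ae ?_).trans_le (lintegral_zero.trans_le zero_le)
      filter_upwards [ae_pos_expMeasure hc] with x hx
      exact Set.indicator_of_notMem (fun h => hsT (by have := Set.mem_Iio.1 h; linarith)) _
  have hup (n : ℕ) : ∀ s, 0 ≤ s → (arrivalOp c η)^[n] (fun _ => 1) s ≤
      R s + q ^ n * (Set.Iio T).indicator (fun _ => 1) s := by
    induction n with
    | zero =>
      intro s hs
      by_cases hsT : s < T
      · simp [hsT]
      · have : ∫⁻ y in Set.Ioi s, (1 - η y) = 0 :=
          (setLIntegral_congr_fun measurableSet_Ioi fun y hy => by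
            rw [hT y ((not_lt.1 hsT).trans_lt hy), tsub_self]).trans lintegral_zero
        simp [hR, this]
    | succ n ih =>
      intro s hs
      rw [Function.iterate_succ_apply']
      have hmi : Measurable ((Set.Iio T).indicator fun _ => (1 : ℝ≥0∞)) :=
        measurable_const.indicator measurableSet_Iio
      calc arrivalOp c η ((arrivalOp c η)^[n] fun _ => 1) s
          ≤ ∫⁻ x, (η (s + x) * R (s + x) +
              q ^ n * (Set.Iio T).indicator (fun _ => 1) (s + x)) ∂expMeasure c := by
            refine lintegral_mono_ae ?_
            filter_upwards [ae_pos_expMeasure hc] with x hx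
            calc _ ≤ η (s + x) * (R (s + x) + q ^ n * (Set.Iio T).indicator (fun _ => 1) (s + x)) :=
                  mul_le_mul_right (ih _ (by linarith)) _
              _ ≤ _ := by
                rw [mul_add]
                exact add_le_add_right (mul_le_of_le_one_left' (hη1 _)) _
        _ = arrivalOp c η R s +
              q ^ n * ∫⁻ x, (Set.Iio T).indicator (fun _ => 1) (s + x) ∂expMeasure c := by
            rw [lintegral_add_right _ (by fun_prop), lintegral_const_mul _ (by fun_prop)]
            rfl
        _ ≤ _ := by
            rw [hfix, pow_succ, mul_assoc]
            exact add_le_add_right (mul_le_mul_right (hind s hs) _) _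
  have hq0 : Filter.Tendsto (fun n => R 0 + q ^ n) Filter.atTop (nhds (R 0)) := by
    simpa using (ENNReal.tendsto_pow_atTop_nhds_zero_of_lt_one
      (expMeasure_Iio_lt_one hc hT0)).const_add (R 0)
  refine tendsto_of_tendsto_of_tendsto_of_le_of_le tendsto_const_nhds hq0 (fun n => hlow n 0)
    fun n => (hup n 0 le_rfl).trans (add_le_add_right (mul_le_of_le_one_right' ?_) _)
  exact Set.indicator_le_self' (fun _ _ => zero_le) _

/-! ### Marked arrival times. -/

section

variable {Ω M : Type*} [MeasurableSpace Ω] [MeasurableSpace M]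

/-- Conditioning on the first n gaps and marks absorbs the last factor into φ, replacing it by its
image under the operator. Hence φ must stay general in the induction. -/
theorem lintegral_prod_arrivals {P : Measure Ω} [IsProbabilityMeasure P] {c : ℝ} (hc : 0 < c)
    {E : ℕ → Ω → ℝ} {U : ℕ → Ω → M} {ρ : Measure M} [IsProbabilityMeasure ρ]
    (hlaw : ∀ k, HasLaw (fun ω => (E k ω, U k ω)) ((expMeasure c).prod ρ) P)
    (hind : iIndepFun (fun k ω => (E k ω, U k ω)) P) {h : ℝ × M → ℝ≥0∞} (hh : Measurable h)
    (n : ℕ) {φ : ℝ → ℝ≥0∞} (hφ : Measurable φ) :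
    ∫⁻ ω, (∏ k ∈ Finset.range n, h (∑ j ∈ Finset.range (k + 1), E j ω, U k ω)) *
        φ (∑ j ∈ Finset.range n, E j ω) ∂P =
      (arrivalOp c fun t => ∫⁻ u, h (t, u) ∂ρ)^[n] φ 0 := by
  have hprob := isProbabilityMeasure_expMeasure hc
  have hη : Measurable fun t => ∫⁻ u, h (t, u) ∂ρ := hh.lintegral_prod_right'
  induction n generalizing φ with
  | zero => simp
  | succ n ih =>
    rw [Function.iterate_succ_apply, ← ih (measurable_arrivalOp hc hη hφ)]
    have hY (k : ℕ) : AEMeasurable (fun ω => (E k ω, U k ω)) P := (hlaw k).aemeasurable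
    have hE (k : ℕ) : AEMeasurable (E k) P := measurable_fst.comp_aemeasurable (hY k)
    have hU (k : ℕ) : AEMeasurable (U k) P := measurable_snd.comp_aemeasurable (hY k)
    let W : Ω → ℝ≥0∞ × ℝ := fun ω =>
      (∏ k ∈ Finset.range n, h (∑ j ∈ Finset.range (k + 1), E j ω, U k ω),
        ∑ j ∈ Finset.range n, E j ω)
    have hsum (k : ℕ) : AEMeasurable (fun ω => ∑ j ∈ Finset.range k, E j ω) P :=
      Finset.aemeasurable_fun_sum _ fun j _ => hE j
    have hW : AEMeasurable W P := (Finset.aemeasurable_fun_prod _ fun k _ =>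
      hh.comp_aemeasurable ((hsum (k + 1)).prodMk (hU k))).prodMk (hsum n)
    -- Extension by 0 lets partial sums run over ℕ. It exhibits `W` as a measurable function of the
    -- first n pairs, hence independent of the next one.
    let e : ((Finset.range n) → ℝ × M) → ℕ → ℝ := fun y j =>
      if hj : j ∈ Finset.range n then (y ⟨j, hj⟩).1 else 0
    have he (j : ℕ) : Measurable fun y => e y j := by
      by_cases hj : j ∈ Finset.range n
      · simp only [e, hj, dite_true]; fun_prop
      · simp only [e, hj, dite_false]; fun_prop
    let F : ((Finset.range n) → ℝ × M) → ℝ≥0∞ × ℝ := fun y =>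
      (∏ k : Finset.range n, h (∑ j ∈ Finset.range (k + 1), e y j, (y k).2),
        ∑ j ∈ Finset.range n, e y j)
    have hF : Measurable F := by fun_prop
    have hFW : F ∘ (fun ω (i : Finset.range n) => (E i ω, U i ω)) = W := by
      funext ω
      have hej (j : ℕ) (hj : j ∈ Finset.range n) :
          e (fun i : Finset.range n => (E i ω, U i ω)) j = E j ω := by simp only [e, hj, dite_true]
      refine Prod.ext ?_ (Finset.sum_congr rfl hej)
      have hk (k : Finset.range n) : ∑ j ∈ Finset.range (k + 1),
          e (fun i : Finset.range n => (E i ω, U i ω)) j =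
            ∑ j ∈ Finset.range (k + 1), E j ω :=
        Finset.sum_congr rfl fun j hj => hej j (by
          have := Finset.mem_range.1 k.2; have := Finset.mem_range.1 hj
          exact Finset.mem_range.2 (by lia))
      simp only [F, W, Function.comp_apply, hk]
      exact Finset.prod_coe_sort _
        fun k => h (∑ j ∈ Finset.range (k + 1), E j ω, U k ω)
    have hWY : IndepFun W (fun ω => (E n ω, U n ω)) P := by
      have := (hind.indepFun_finset₀ (Finset.range n) {n} (by simp) hY).comp hF
        (measurable_pi_apply (⟨n, Finset.mem_singleton_self n⟩ : ({n} : Finset ℕ)))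
      rwa [hFW] at this
    have hG : Measurable fun p : (ℝ≥0∞ × ℝ) × ℝ × M =>
        p.1.1 * (h (p.1.2 + p.2.1, p.2.2) * φ (p.1.2 + p.2.1)) := by fun_prop
    have key := lintegral_comp_prodMk_of_indepFun hW (hY n) hWY hG
    simp only [(hlaw n).map_eq] at key
    refine Eq.trans (lintegral_congr fun ω => ?_) (key.trans (lintegral_congr fun ω => ?_))
    · simp only [W, Finset.prod_range_succ, Finset.sum_range_succ, mul_assoc]
    · have hG' (s : ℝ) : Measurable fun p : ℝ × M => h (s + p.1, p.2) * φ (s + p.1) := by fun_prop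
      rw [lintegral_const_mul _ (hG' _), lintegral_prod _ (hG' _).aemeasurable]
      congr 1
      refine lintegral_congr fun x => ?_
      have hhx : Measurable fun u => h ((W ω).2 + x, u) := hh.comp measurable_prodMk_left
      exact lintegral_mul_const (φ ((W ω).2 + x)) hhx

/-- The arrival times of a Poisson process with rate `c` on the half-line, with i.i.d. marks. -/
theorem hasPoissonLaplace_arrivals {P : Measure Ω} [IsProbabilityMeasure P] {c : ℝ} (hc : 0 < c)
    {E : ℕ → Ω → ℝ} {U : ℕ → Ω → M} {ρ : Measure M} [IsProbabilityMeasure ρ]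
    (hlaw : ∀ k, HasLaw (fun ω => (E k ω, U k ω)) ((expMeasure c).prod ρ) P)
    (hind : iIndepFun (fun k ω => (E k ω, U k ω)) P) {f : ℝ × M → ℝ≥0∞} (hf : Measurable f) :
    HasPoissonLaplace
      (fun ω => atoms fun k => (∑ j ∈ Finset.range (k + 1), E j ω, U k ω))
      ((ENNReal.ofReal c • volume.restrict (Set.Ioi 0)).prod ρ) P f := by
  have hE (k : ℕ) : AEMeasurable (E k) P := measurable_fst.comp_aemeasurable (hlaw k).aemeasurable
  have hX (k : ℕ) : AEMeasurable (fun ω => (∑ j ∈ Finset.range (k + 1), E j ω, U k ω)) P :=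
    (Finset.aemeasurable_fun_sum _ fun j _ => hE j).prodMk
      (measurable_snd.comp_aemeasurable (hlaw k).aemeasurable)
  have hset (n : ℕ) : MeasurableSet {p : ℝ × M | p.1 ≤ n} :=
    measurableSet_le measurable_fst measurable_const
  have hfn (n : ℕ) : Measurable ({p : ℝ × M | p.1 ≤ n}.indicator f) := hf.indicator (hset n)
  -- Cutting f off after time n makes the averaged factor equal to 1 beyond n, as convergence of the
  -- iterates requires.
  refine .of_tendsto (aemeasurable_atoms hX) hfn (fun n m h => ?_) (fun x => ?_) fun n => ?_
  · exact Set.indicator_le_indicator_of_subset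
      (fun p hp => le_trans (Set.mem_ofPred_eq ▸ hp) (by exact_mod_cast h)) fun _ => zero_le
  · refine tendsto_const_nhds.congr' ?_
    obtain ⟨N, hN⟩ := exists_nat_ge x.1
    filter_upwards [Filter.eventually_ge_atTop N] with n hn
    refine (Set.indicator_of_mem (s := {p : ℝ × M | p.1 ≤ n}) ?_ f).symm
    exact hN.trans (by exact_mod_cast hn)
  · generalize hg : {p : ℝ × M | p.1 ≤ n}.indicator f = g
    have hgm : Measurable g := hg ▸ hfn n
    have hg0 (t : ℝ) (ht : n < t) (u : M) : g (t, u) = 0 := by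
      rw [← hg]
      exact Set.indicator_of_notMem (s := {p : ℝ × M | p.1 ≤ n}) (fun h => not_le.2 ht h) f
    rw [hasPoissonLaplace_atoms_iff
      (X := fun k ω => (∑ j ∈ Finset.range (k + 1), E j ω, U k ω)) hgm,
      lintegral_prod _ (by fun_prop), lintegral_smul_measure]
    refine tendsto_nhds_unique (tendsto_lintegral_prod_expNeg hX hgm) ?_
    have hη : Measurable fun t => ∫⁻ u, expNeg (g (t, u)) ∂ρ :=
      (measurable_expNeg.comp hgm).lintegral_prod_right'
    have hη1 (t : ℝ) : ∫⁻ u, expNeg (g (t, u)) ∂ρ ≤ 1 :=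
      (lintegral_mono fun u => expNeg_le_one _).trans_eq (by simp)
    convert! tendsto_iterate_arrivalOp hc hη
      hη1 n.cast_nonneg
      (fun t ht => by simp [hg0 t ht]) using 2 with k
    · rw [← lintegral_prod_arrivals hc hlaw hind (h := fun p => expNeg (g p)) (by fun_prop) k
        measurable_const]
      simp
    · rw [smul_eq_mul]
      congr 2
      refine lintegral_congr fun t => ?_
      rw [one_sub_lintegral_expNeg ρ (by fun_prop)]

end

/-! ### Changes of variables between the gamma and beta rates. -/

theorem image_div_sub_Ioo {θ : ℝ} (hθ : 0 < θ) :
    (fun u => θ / u - θ) '' Set.Ioo 0 1 = Set.Ioi 0 := by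
  ext x
  simp only [Set.mem_image, Set.mem_Ioo, Set.mem_Ioi]
  constructor
  · rintro ⟨u, ⟨h0, h1⟩, rfl⟩
    rw [sub_pos, lt_div_iff₀ h0]
    nlinarith
  · intro hx
    have h : 0 < θ + x := by linarith
    refine ⟨θ / (θ + x), ⟨by positivity, (div_lt_one h).2 (by linarith)⟩, ?_⟩
    field_simp
    ring

/-- Substitution g = θ/u - θ, the inverse of u = θ/(θ + g), with |dg/du| = θ/u². -/
theorem lintegral_gammaMeasure_ratio (a r : ℝ) {θ : ℝ} (hθ : 0 < θ) {φ : ℝ → ℝ≥0∞}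
    (hφ : Measurable φ) :
    ∫⁻ g, φ (θ / (θ + g)) ∂gammaMeasure a r =
      ∫⁻ u in Set.Ioo 0 1, gammaPDF a r (θ / u - θ) * ENNReal.ofReal (θ / u ^ 2) * φ u := by
  rw [lintegral_gammaMeasure a r (by fun_prop), ← image_div_sub_Ioo hθ,
    lintegral_image_eq_lintegral_abs_deriv_mul measurableSet_Ioo (f' := fun u => -(θ / u ^ 2))]
  · refine setLIntegral_congr_fun measurableSet_Ioo fun u hu => ?_
    have h0 : u ≠ 0 := hu.1.ne'
    have h1 : θ / (θ + (θ / u - θ)) = u := by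
      rw [add_sub_cancel, div_div_cancel₀ hθ.ne']
    simp only [h1, abs_neg, abs_of_nonneg (show 0 ≤ θ / u ^ 2 by positivity)]
    ring
  · intro u hu
    have := (((hasDerivAt_inv hu.1.ne').const_mul θ).sub_const θ).hasDerivWithinAt
      (s := Set.Ioo 0 1)
    convert! this using 1
    ring
  · intro u hu v hv huv
    have h : θ / u = θ / v := by simpa using huv
    rw [div_eq_div_iff hu.1.ne' hv.1.ne'] at h
    exact (mul_left_cancel₀ hθ.ne' h).symm

theorem gammaMeasure_map_ratio (a r : ℝ) {θ : ℝ} (hθ : 0 < θ) :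
    (gammaMeasure a r).map (fun g => θ / (θ + g)) =
      (volume.restrict (Set.Ioo 0 1)).withDensity
        fun u => gammaPDF a r (θ / u - θ) * ENNReal.ofReal (θ / u ^ 2) := by
  have hm := measurable_gammaPDF a r
  refine Measure.ext_of_lintegral _ fun φ hφ => ?_
  rw [lintegral_map hφ (by fun_prop), lintegral_gammaMeasure_ratio a r hθ hφ,
    lintegral_withDensity_eq_lintegral_mul _ (by fun_prop) hφ]
  rfl

theorem lintegral_gammaProcessRate (γ α : ℝ) {F : ℝ → ℝ≥0∞} (hF : Measurable F) :
    ∫⁻ θ, F θ ∂gammaProcessRate γ α 0 =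
      ∫⁻ θ in Set.Ioi 0, ENNReal.ofReal (γ * α * θ⁻¹ * Real.exp (-α * θ)) * F θ := by
  rw [gammaProcessRate, lintegral_withDensity_eq_lintegral_mul _ (by fun_prop) hF]
  refine setLIntegral_congr_fun measurableSet_Ioi fun θ hθ => ?_
  simp [Real.rpow_neg_one]

theorem lintegral_betaProcessRate (γ : ℝ) {α : ℝ} (hα : 0 < α) {F : ℝ → ℝ≥0∞} (hF : Measurable F) :
    ∫⁻ u, F u ∂betaProcessRate γ α 0 =
      ∫⁻ u in Set.Ioo 0 1, ENNReal.ofReal (γ * α * u⁻¹ * (1 - u) ^ (α - 1)) * F u := by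
  rw [betaProcessRate, lintegral_withDensity_eq_lintegral_mul _ (by fun_prop) hF,
    -- The endpoint u = 1 is Lebesgue-null.
    setLIntegral_congr Ioo_ae_eq_Ioc.symm]
  refine setLIntegral_congr_fun measurableSet_Ioo fun u hu => ?_
  simp [Real.rpow_neg_one, Real.Gamma_add_one hα.ne', (Real.Gamma_pos_of_pos hα).ne']

theorem setLIntegral_gammaPDF {a r : ℝ} (ha : 0 < a) (hr : 0 < r) :
    ∫⁻ x in Set.Ioi 0, gammaPDF a r x = 1 := by
  have := isProbabilityMeasure_gammaMeasure ha hr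
  have h := lintegral_gammaMeasure a r measurable_one
  simpa using h.symm

/-- The factors e^{-αθ} and e^{-α(θ/u - θ)} combine to e^{-αθ/u}, and the powers of θ to θ^{α-1}.
Only a Gam(α, α/u) density in θ and a function of u remain. -/
theorem gammaProcessRate_mul_gammaPDF {γ α θ u : ℝ} (hγ : 0 < γ) (hα : 0 < α) (hθ : 0 < θ)
    (hu0 : 0 < u) (hu1 : u < 1) :
    ENNReal.ofReal (γ * α * θ⁻¹ * Real.exp (-α * θ)) *
        (gammaPDF α α (θ / u - θ) * ENNReal.ofReal (θ / u ^ 2)) =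
      ENNReal.ofReal (γ * α * u⁻¹ * (1 - u) ^ (α - 1)) * gammaPDF α (α / u) θ := by
  have h1u : 0 < 1 - u := by linarith
  have hG := Real.Gamma_pos_of_pos hα
  have hx : θ / u - θ = θ * (1 - u) / u := by field_simp
  have hx0 : 0 ≤ θ / u - θ := by rw [hx]; positivity
  rw [gammaPDF_of_nonneg hx0, gammaPDF_of_nonneg hθ.le, ← ENNReal.ofReal_mul (by positivity),
    ← ENNReal.ofReal_mul (by positivity), ← ENNReal.ofReal_mul (by positivity)]
  congr 1
  have he : Real.exp (-(α / u * θ)) = Real.exp (-α * θ) * Real.exp (-(α * (θ / u - θ))) := by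
    rw [← Real.exp_add]; congr 1; ring
  have hp : (θ / u - θ) ^ (α - 1) = θ ^ (α - 1) * (1 - u) ^ (α - 1) / (u ^ α / u) := by
    rw [hx, Real.div_rpow (by positivity) hu0.le, Real.mul_rpow hθ.le h1u.le,
      Real.rpow_sub_one hu0.ne']
  rw [he, hp, Real.div_rpow hα.le hu0.le]
  have := Real.rpow_pos_of_pos hu0 α
  field_simp

theorem lintegral_gammaProcessRate_ratio {γ α : ℝ} (hγ : 0 < γ) (hα : 0 < α) {φ : ℝ → ℝ≥0∞}
    (hφ : Measurable φ) :
    ∫⁻ θ, ∫⁻ g, φ (θ / (θ + g)) ∂gammaMeasure α α ∂gammaProcessRate γ α 0 =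
      ∫⁻ u, φ u ∂betaProcessRate γ α 0 := by
  have hp := isProbabilityMeasure_gammaMeasure hα hα
  have hm := measurable_gammaPDF α α
  have hF : Measurable fun θ => ∫⁻ g, φ (θ / (θ + g)) ∂gammaMeasure α α := by
    have : Measurable fun p : ℝ × ℝ => φ (p.1 / (p.1 + p.2)) := by fun_prop
    exact this.lintegral_prod_right'
  rw [lintegral_gammaProcessRate _ _ hF, lintegral_betaProcessRate γ hα hφ]
  calc _ = ∫⁻ θ in Set.Ioi 0, ∫⁻ u in Set.Ioo 0 1,
        ENNReal.ofReal (γ * α * θ⁻¹ * Real.exp (-α * θ)) *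
          (gammaPDF α α (θ / u - θ) * ENNReal.ofReal (θ / u ^ 2)) * φ u := by
        refine setLIntegral_congr_fun measurableSet_Ioi fun θ hθ => ?_
        rw [lintegral_gammaMeasure_ratio α α hθ hφ, ← lintegral_const_mul' _ _ ENNReal.ofReal_ne_top]
        simp_rw [mul_assoc]
    _ = ∫⁻ u in Set.Ioo 0 1, ∫⁻ θ in Set.Ioi 0,
        ENNReal.ofReal (γ * α * θ⁻¹ * Real.exp (-α * θ)) *
          (gammaPDF α α (θ / u - θ) * ENNReal.ofReal (θ / u ^ 2)) * φ u :=
        lintegral_lintegral_swap (Measurable.aemeasurable (by fun_prop))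
    _ = _ := by
        refine setLIntegral_congr_fun measurableSet_Ioo fun u hu => ?_
        calc _ = ∫⁻ θ in Set.Ioi 0, ENNReal.ofReal (γ * α * u⁻¹ * (1 - u) ^ (α - 1)) *
              gammaPDF α (α / u) θ * φ u :=
              setLIntegral_congr_fun measurableSet_Ioi fun θ hθ => by
                rw [gammaProcessRate_mul_gammaPDF hγ hα hθ hu.1 hu.2]
          _ = _ := by
              have := measurable_gammaPDF α (α / u)
              rw [lintegral_mul_const _ (by fun_prop), lintegral_const_mul _ this,
                setLIntegral_gammaPDF hα (div_pos hα hu.1), mul_one]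

/-- The integrand is the derivative of -exp(-a eᵗ), which runs from -e^{-a} at t = 0 to 0. -/
theorem setLIntegral_Ioi_exp_mul_exp_neg {a : ℝ} (ha : 0 < a) :
    ∫⁻ t in Set.Ioi 0, ENNReal.ofReal (a * Real.exp t * Real.exp (-(a * Real.exp t))) =
      ENNReal.ofReal (Real.exp (-a)) := by
  have hd (t : ℝ) : HasDerivAt (fun t => -Real.exp (-(a * Real.exp t)))
      (a * Real.exp t * Real.exp (-(a * Real.exp t))) t := by
    convert! ((((Real.hasDerivAt_exp t).const_mul a).fun_neg).exp).fun_neg using 1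
    ring
  have hlim : Filter.Tendsto (fun t => -Real.exp (-(a * Real.exp t))) Filter.atTop (nhds 0) := by
    rw [← neg_zero]
    exact (Real.tendsto_exp_neg_atTop_nhds_zero.comp
      (Real.tendsto_exp_atTop.const_mul_atTop ha)).neg
  have h0 (t : ℝ) : 0 ≤ a * Real.exp t * Real.exp (-(a * Real.exp t)) := by positivity
  rw [← ofReal_integral_eq_lintegral_ofReal
    (integrableOn_Ioi_deriv_of_nonneg' (fun t _ => hd t) (fun t _ => h0 t) hlim) (.of_forall h0),
    integral_Ioi_of_hasDerivAt_of_nonneg' (fun t _ => hd t) (fun t _ => h0 t) hlim]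
  simp

theorem image_mul_const_Ioi {c : ℝ} (hc : 0 < c) :
    (fun x => x * c) '' Set.Ioi 0 = Set.Ioi 0 := by
  ext x
  simp only [Set.mem_image, Set.mem_Ioi]
  exact ⟨by rintro ⟨y, hy, rfl⟩; positivity,
    fun hx => ⟨x / c, by positivity, div_mul_cancel₀ x hc.ne'⟩⟩

/-- This is the rate computation behind the series ∑ V_k e^{-Γ_k} δ_{ψ_k} for the gamma process.
Substituting v = θ eᵗ and exchanging integrals leaves the exact derivative above with a = αθ, which
produces e^{-αθ}. -/
theorem lintegral_expMeasure_mul_exp_neg {γ α : ℝ} (hγ : 0 < γ) (hα : 0 < α) {φ : ℝ → ℝ≥0∞}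
    (hφ : Measurable φ) :
    ∫⁻ t, ∫⁻ v, φ (v * Real.exp (-t)) ∂expMeasure α
        ∂(ENNReal.ofReal (α * γ) • volume.restrict (Set.Ioi 0)) =
      ∫⁻ θ, φ θ ∂gammaProcessRate γ α 0 := by
  rw [lintegral_gammaProcessRate _ _ hφ, lintegral_smul_measure, smul_eq_mul,
    ← lintegral_const_mul' _ _ ENNReal.ofReal_ne_top]
  calc _ = ∫⁻ t in Set.Ioi 0, ∫⁻ θ in Set.Ioi 0, ENNReal.ofReal (γ * α * θ⁻¹) *
        ENNReal.ofReal (α * θ * Real.exp t * Real.exp (-(α * θ * Real.exp t))) * φ θ := by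
        refine setLIntegral_congr_fun measurableSet_Ioi fun t _ => ?_
        rw [lintegral_expMeasure hα (by fun_prop), ← image_mul_const_Ioi (Real.exp_pos t),
          lintegral_image_eq_lintegral_abs_deriv_mul measurableSet_Ioi
            (f' := fun _ => Real.exp t), ← lintegral_const_mul' _ _ ENNReal.ofReal_ne_top]
        · rw [image_mul_const_Ioi (Real.exp_pos t)]
          refine setLIntegral_congr_fun measurableSet_Ioi fun θ hθ => ?_
          have hθ' : 0 < θ := hθ
          have e1 : θ * Real.exp t * Real.exp (-t) = θ := by
            rw [mul_assoc, ← Real.exp_add]; simp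
          simp only [e1, Real.abs_exp]
          rw [expNeg_ofReal (by positivity), ← mul_assoc, ← mul_assoc,
            ← ENNReal.ofReal_mul (by positivity), ← ENNReal.ofReal_mul (by positivity),
            ← ENNReal.ofReal_mul (by positivity), ← ENNReal.ofReal_mul (by positivity)]
          congr 2
          field_simp
        · intro x _
          simpa using ((hasDerivAt_id x).mul_const (Real.exp t)).hasDerivWithinAt
        · exact fun x _ y _ h => mul_right_cancel₀ (Real.exp_pos t).ne' h
    _ = ∫⁻ θ in Set.Ioi 0, ∫⁻ t in Set.Ioi 0, ENNReal.ofReal (γ * α * θ⁻¹) *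
        ENNReal.ofReal (α * θ * Real.exp t * Real.exp (-(α * θ * Real.exp t))) * φ θ :=
        lintegral_lintegral_swap (Measurable.aemeasurable (by fun_prop))
    _ = _ := by
        refine setLIntegral_congr_fun measurableSet_Ioi fun θ hθ => ?_
        have hθ' : 0 < θ := hθ
        rw [lintegral_mul_const _ (by fun_prop), lintegral_const_mul _ (by fun_prop),
          setLIntegral_Ioi_exp_mul_exp_neg (mul_pos hα hθ'), ← ENNReal.ofReal_mul (by positivity),
          neg_mul]

/-! ### Image rate measures with locations. -/

section

variable {Ψ : Type*} [MeasurableSpace Ψ] (H : Measure Ψ) [IsProbabilityMeasure H]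

instance (γ l d : ℝ) : SFinite (gammaProcessRate γ l d) := by
  unfold gammaProcessRate; infer_instance

instance (γ α d : ℝ) : SFinite (betaProcessRate γ α d) := by
  unfold betaProcessRate; infer_instance

theorem gammaProcessRate_prod_map_ratio {γ α : ℝ} (hγ : 0 < γ) (hα : 0 < α) :
    (((gammaProcessRate γ α 0).prod H).prod (gammaMeasure α α)).map
        (fun p => (p.1.1 / (p.1.1 + p.2), p.1.2)) = (betaProcessRate γ α 0).prod H := by
  have hp := isProbabilityMeasure_gammaMeasure hα hα
  refine Measure.ext_of_lintegral _ fun φ hφ => ?_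
  have hm : Measurable fun p : (ℝ × Ψ) × ℝ => φ (p.1.1 / (p.1.1 + p.2), p.1.2) := by fun_prop
  rw [lintegral_map hφ (by fun_prop), lintegral_prod _ hm.aemeasurable,
    lintegral_prod_symm _ hm.lintegral_prod_right'.aemeasurable,
    lintegral_prod_symm _ hφ.aemeasurable]
  refine lintegral_congr fun ψ => ?_
  exact lintegral_gammaProcessRate_ratio hγ hα (φ := fun u => φ (u, ψ)) (by fun_prop)

/-- With θ = v e^{-t} the weight is θ/(θ + g), so the map factors through the gamma process rate
followed by the stochastic mapping. -/
theorem arrivals_prod_map {γ α : ℝ} (hγ : 0 < γ) (hα : 0 < α) :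
    ((ENNReal.ofReal (α * γ) • volume.restrict (Set.Ioi 0)).prod
        ((expMeasure α).prod ((gammaMeasure α α).prod H))).map
        (fun p => ((1 + p.2.2.1 * p.2.1⁻¹ * Real.exp p.1)⁻¹, p.2.2.2)) =
      (betaProcessRate γ α 0).prod H := by
  have hp := isProbabilityMeasure_gammaMeasure hα hα
  have hp' := isProbabilityMeasure_expMeasure hα
  refine Measure.ext_of_lintegral _ fun φ hφ => ?_
  have hΦ : Measurable fun u => ∫⁻ ψ, φ (u, ψ) ∂H := hφ.lintegral_prod_right'
  have hF : Measurable fun θ => ∫⁻ g, ∫⁻ ψ, φ (θ / (θ + g), ψ) ∂H ∂gammaMeasure α α := by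
    have : Measurable fun p : ℝ × ℝ => ∫⁻ ψ, φ (p.1 / (p.1 + p.2), ψ) ∂H :=
      hΦ.comp (by fun_prop : Measurable fun p : ℝ × ℝ => p.1 / (p.1 + p.2))
    exact this.lintegral_prod_right'
  rw [lintegral_map hφ (by fun_prop), lintegral_prod _ (Measurable.aemeasurable (by fun_prop)),
    lintegral_prod _ hφ.aemeasurable, ← lintegral_gammaProcessRate_ratio hγ hα hΦ,
    ← lintegral_expMeasure_mul_exp_neg hγ hα hF]
  refine lintegral_congr fun t => ?_
  rw [lintegral_prod _ (Measurable.aemeasurable (by fun_prop))]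
  refine lintegral_congr_ae ?_
  -- Rewriting the weight divides by v e^{-t}, so it holds only for almost every v.
  filter_upwards [ae_pos_expMeasure hα] with v hv
  rw [lintegral_prod _ (Measurable.aemeasurable (by fun_prop))]
  refine lintegral_congr fun g => lintegral_congr fun ψ => ?_
  have hθ : v * Real.exp (-t) ≠ 0 := by positivity
  have e : (1 + g * v⁻¹ * Real.exp t)⁻¹ = v * Real.exp (-t) / (v * Real.exp (-t) + g) := by
    have : v * Real.exp (-t) + g = v * Real.exp (-t) * (1 + g * v⁻¹ * Real.exp t) := by
      rw [Real.exp_neg]; field_simp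
    rw [this, div_mul_eq_div_div, div_self hθ, one_div]
  rw [e]

end

/-! ### The main theorem. -/

theorem mainTheorem4 {Ω Ψ : Type*} [MeasurableSpace Ω] [MeasurableSpace Ψ]
    (P : Measure Ω) [IsProbabilityMeasure P] (H : Measure Ψ) [IsProbabilityMeasure H]
    (γ α : ℝ) (hγ : 0 < γ) (hα : 0 < α) :
    -- density of the stochastic mapping `θ ↦ θ / (θ + G)`
    (∀ θ : ℝ, 0 < θ →
      (gammaMeasure α α).map (fun g => θ / (θ + g)) =
        (volume.restrict (Set.Ioo 0 1)).withDensity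
          fun u => gammaPDF α α (θ / u - θ) * ENNReal.ofReal (θ / u ^ 2)) ∧
    -- mapping the atoms of a gamma process
    (∀ (θ : ℕ → Ω → ℝ) (ψ : ℕ → Ω → Ψ) (G : ℕ → Ω → ℝ),
      (∀ k, Measurable (θ k)) → (∀ k, Measurable (ψ k)) →
      IsPoissonProcess (fun ω => pointMeasure (fun k => θ k ω) (fun k => ψ k ω))
        ((gammaProcessRate γ α 0).prod H) P →
      (∀ k, HasLaw (G k) (gammaMeasure α α) P) → iIndepFun G P →
      IndepFun (fun ω (k : ℕ) => (θ k ω, ψ k ω)) (fun ω (k : ℕ) => G k ω) P →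
      IsCRM (fun ω => weightedMeasure (fun k => θ k ω / (θ k ω + G k ω)) (fun k => ψ k ω))
        (betaProcessRate γ α 0) H P) ∧
    -- series representation
    (∀ (E V G : ℕ → Ω → ℝ) (ψ : ℕ → Ω → Ψ),
      (∀ k, HasLaw (fun ω => (E k ω, V k ω, G k ω, ψ k ω))
        ((expMeasure (α * γ)).prod
          ((expMeasure α).prod ((gammaMeasure α α).prod H))) P) →
      iIndepFun (fun k ω => (E k ω, V k ω, G k ω, ψ k ω)) P →
      IsCRM
        (fun ω => weightedMeasure
          (fun k => (1 + G k ω * (V k ω)⁻¹ *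
            Real.exp (∑ j ∈ Finset.range (k + 1), E j ω))⁻¹)
          (fun k => ψ k ω))
        (betaProcessRate γ α 0) H P) := by
  have hp := isProbabilityMeasure_gammaMeasure hα hα
  have hp' := isProbabilityMeasure_expMeasure hα
  refine ⟨fun θ hθ => gammaMeasure_map_ratio α α hθ,
    fun θ ψ G hθ hψ hN hG hGi hind => ?_, fun E V G ψ hlaw hind => ?_⟩
  · have hX (k : ℕ) : AEMeasurable (fun ω => (θ k ω, ψ k ω)) P :=
      ((hθ k).prodMk (hψ k)).aemeasurable
    -- Mark the gamma process by G, then map. The hypothesis `hN` applies because `pointMeasure`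
    -- unfolds to `atoms` of the pairs (θ k, ψ k).
    have h := fun f hf => hasPoissonLaplace_atoms_map (f := f)
      (T := fun p : (ℝ × Ψ) × ℝ => (p.1.1 / (p.1.1 + p.2), p.1.2)) (by fun_prop)
      (fun f hf => hasPoissonLaplace_marks (f := f) (X := fun k ω => (θ k ω, ψ k ω)) hX hG hGi hind
        (fun f hf => hN.hasPoissonLaplace hf) hf) hf
    rw [gammaProcessRate_prod_map_ratio H hγ hα] at h
    simp_rw [← collapse_pointMeasure]
    refine (isPoissonProcess_of_hasPoissonLaplace ?_ h).isCRM_collapse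
    exact aemeasurable_atoms (X := fun k ω => (θ k ω / (θ k ω + G k ω), ψ k ω)) fun k =>
      (by fun_prop : Measurable fun p : (ℝ × Ψ) × ℝ =>
        (p.1.1 / (p.1.1 + p.2), p.1.2)).comp_aemeasurable ((hX k).prodMk (hG k).aemeasurable)
  · have hT : Measurable fun p : ℝ × ℝ × ℝ × Ψ =>
        ((1 + p.2.2.1 * p.2.1⁻¹ * Real.exp p.1)⁻¹, p.2.2.2) := by fun_prop
    -- Here V, G and ψ together form the mark of each arrival time.
    have h := fun f hf => hasPoissonLaplace_atoms_map (f := f) hT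
      (fun f hf => hasPoissonLaplace_arrivals (f := f) (mul_pos hα hγ) hlaw hind hf) hf
    rw [arrivals_prod_map H hγ hα] at h
    simp_rw [← collapse_pointMeasure]
    refine (isPoissonProcess_of_hasPoissonLaplace ?_ h).isCRM_collapse
    have hE (k : ℕ) : AEMeasurable (E k) P :=
      measurable_fst.comp_aemeasurable (hlaw k).aemeasurable
    refine aemeasurable_atoms (X := fun k ω => ((1 + G k ω * (V k ω)⁻¹ *
      Real.exp (∑ j ∈ Finset.range (k + 1), E j ω))⁻¹, ψ k ω)) fun k =>
      hT.comp_aemeasurable (f := fun ω => (∑ j ∈ Finset.range (k + 1), E j ω, V k ω, G k ω, ψ k ω))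
        ((Finset.aemeasurable_fun_sum _ fun j _ => hE j).prodMk
          (measurable_snd.comp_aemeasurable (hlaw k).aemeasurable))
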